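/- Let $k$ be an index set; $\mathbb N_0^k$ and $\mathbb Z^k$ denote the finitely supported functions on $k$ with values in $\mathbb N_0$ and $\mathbb Z$. A *semimultiplicative set* is a set with a partially defined multiplication such that $(st)u$ is defined if and only if $s(tu)$ is, and then both agree. A *$k$-semigraph* is a semimultiplicative set $T$ with a map $d:T\to\mathbb N_0^k$ such that $d(xy)=d(x)+d(y)$ whenever $xy$ is defined, and such that for all $x\in T$ and $n_1,n_2\in\mathbb N_0^k$ with $d(x)=n_1+n_2$ there are unique $x_1,x_2\in T$ with $x=x_1x_2$, $d(x_1)=n_1$, $d(x_2)=n_2$. It is *finitely aligned* if for all $x,y\in T$ the set $T^{(\min)}(x,y)$ of all $(\alpha,\beta)\in T\times T$ such that $x\alpha$ and $y\beta$ are defined, $x\alpha=y\beta$ and $d(x\alpha)=d(x)\vee d(y)$ is finite. A *non-unital finitely aligned $k$-semigraph* is a set $\mathcal T=\mathcal T_1\setminus\{1\}$, where $\mathcal T_1$ is a finitely aligned $k$-semigraph with unit $1$. A *$k$-semigraph algebra* is a complex $*$-algebra $X$ (not necessarily unital) generated by disjoint subsets $\mathcal P,\mathcal T\subseteq X$ such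 that (i) $\mathcal P$ is a set of commuting projections closed under multiplication; (ii) $\mathcal T$ is a set of nonzero partial isometries closed under nonzero products; (iii) $\mathcal T$, with the product of $s,t\in\mathcal T$ defined if and only if $st\neq0$ in $X$, is a non-unital finitely aligned $k$-semigraph with respect to a degree map $d$; (iv) for all $x\in\mathcal T$, $p\in\mathcal P$ there is $q\in\mathcal P$ with $px=xq$; (v) for all $x,y\in\mathcal T$ there are $q_{x,y,\alpha,\beta}\in\mathcal P$ with $x^*y=\sum_{(\alpha,\beta)\in\mathcal T_1^{(\min)}(x,y)}\alpha\, q_{x,y,\alpha,\beta}\,\beta^*$, where $1\in\mathcal T_1$ is identified with the unit of the unitization $\tilde X=X\oplus\mathbb C1$; (vi) the kernel of the canonical homomorphism onto $X$ from the free non-unital $*$-algebra on the letter set $\mathcal T\sqcup\mathcal P$ is generated, as a self-adjoint two-sided ideal, by a set of elements each of which is a linear combination of words of one common degree; here the degree in $\mathbb Z^k$ of a word is the sum of the degrees of its letters, with $d(p)=0$ for $p\in\mathcal P$, $d(t)$ the semigraph degree for $t\in\mathcal T$, and $d(a^*)=-d(a)$. The *core* of $X$ is the linear span of all (images in $X$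 of) words of degree $0$. A *half-standard word* is an element of $\mathcal T_1\mathcal P=\{sp: s\in\mathcal T_1,\ p\in\mathcal P\}$. With $P_x=xx^*$, a *standard projection* is an element of the form $P_x(1-P_{y_1})\cdots(1-P_{y_m})$ with $m\ge0$ and $x,y_1,\dots,y_m$ half-standard words. **Corollary.** Let $X$ be a $k$-semigraph algebra. (a) The core of $X$ is the union of an upward directed (non-empty) family of $*$-subalgebras of $X$, each of which is a finite dimensional $C^*$-algebra and admits a matrix representation, i.e. a $*$-isomorphism onto a finite direct sum $\bigoplus_j M_{n_j}(\mathbb C)$, such that each of the projections corresponding to the diagonal matrix units is a finite sum of mutually orthogonal standard projections. (b) A $C^*$-representation of $X$, i.e. a $*$-homomorphism $\pi$ from $X$ to a $C^*$-algebra, is injective on the core if and only if $\pi(e)\neq0$ for every nonzero standard projection $e$. -/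

import Mathlib

/-! ### Semimultiplicative sets and semigraphs -/

/-- A semimultiplicative set: a set with a partially defined multiplication (`mul s t = none` means
that `st` is not defined) such that `(st)u` is defined iff `s(tu)` is defined, and then both agree.
-/
structure SemimultiplicativeSet (T : Type*) where
  mul : T → T → Option T
  assoc : ∀ s t u : T,
    (mul s t).bind (fun st => mul st u) = (mul t u).bind (fun tu => mul s tu)

/-- The set `T ⊔ {1}`. -/
inductive AdjoinUnit (T : Type*) where
  | one : AdjoinUnit T
  | of : T → AdjoinUnit T

namespace SemimultiplicativeSet

/-- The unitization `T₁ = T ⊔ {1}` of a semimultiplicative set `T`. -/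
def adjoinUnit {T : Type*} (S : SemimultiplicativeSet T) :
    SemimultiplicativeSet (AdjoinUnit T) where
  mul
    | .one, t => some t
    | .of s, .one => some (.of s)
    | .of s, .of t => (S.mul s t).map .of
  assoc := by
    rintro (_ | s) (_ | t) (_ | u)
    · rfl
    · rfl
    · rfl
    · simp
    · rfl
    · rfl
    · simp only [Option.bind_some]
      cases S.mul s t <;> rfl
    · have h := S.assoc s t u
      dsimp only
      cases hst : S.mul s t with
      | none =>
        cases htu : S.mul t u with
        | none => rfl
        | some b => simpa [hst, htu, eq_comm] using h
      | some a =>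
        cases htu : S.mul t u with
        | none => simpa [hst, htu] using h
        | some b =>
          simp only [hst, htu, Option.bind_some] at h
          simp [h]

variable {k T : Type*}

/-- `T` with degree map `d : T → ℕ₀ᵏ` is a `k`-semigraph: the degree is additive and the unique
factorisation property holds. -/
structure IsSemigraph (S : SemimultiplicativeSet T) (d : T → (k →₀ ℕ)) : Prop where
  degree_mul : ∀ x y z : T, S.mul x y = some z → d z = d x + d y
  factorisation : ∀ (x : T) (n₁ n₂ : k →₀ ℕ), d x = n₁ + n₂ →
    ∃! y : T × T, S.mul y.1 y.2 = some x ∧ d y.1 = n₁ ∧ d y.2 = n₂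

/-- The set of minimal common extensions of `x` and `y`: all pairs `(α, β)` such that `xα` and `yβ`
are defined, `xα = yβ` and `d(xα) = d(x) ∨ d(y)`. -/
def minExt (S : SemimultiplicativeSet T) (d : T → (k →₀ ℕ)) (x y : T) : Set (T × T) :=
  {a | ∃ z : T, S.mul x a.1 = some z ∧ S.mul y a.2 = some z ∧ d z = d x ⊔ d y}

/-- A semigraph is finitely aligned if all its sets of minimal common extensions are finite. -/
def FinitelyAligned (S : SemimultiplicativeSet T) (d : T → (k →₀ ℕ)) : Prop :=
  ∀ x y : T, (S.minExt d x y).Finite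

/-- The extension of a degree map on `T` to `T ⊔ {1}` by `d(1) = 0` (the only possible value). -/
def adjoinUnitDegree (d : T → (k →₀ ℕ)) : AdjoinUnit T → (k →₀ ℕ)
  | .one => 0
  | .of t => d t

/-- `T` is a non-unital finitely aligned `k`-semigraph: `T = T₁ \ {1}` for a finitely aligned
`k`-semigraph `T₁` with unit `1`. (The multiplication and the degree map of such a `T₁` are
determined by those of `T`.) -/
structure IsNonUnitalFinitelyAlignedSemigraph (S : SemimultiplicativeSet T)
    (d : T → (k →₀ ℕ)) : Prop where
  isSemigraph : S.adjoinUnit.IsSemigraph (adjoinUnitDegree d)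
  finitelyAligned : S.adjoinUnit.FinitelyAligned (adjoinUnitDegree d)

end SemimultiplicativeSet

/-- A subset `T` of a ring which is closed under nonzero products is a semimultiplicative set: the
product of `s` and `t` is defined iff `st ≠ 0`. -/
noncomputable def nonzeroMul {X : Type*} [NonUnitalRing X] (T : Set X)
    (hT : ∀ s ∈ T, ∀ t ∈ T, s * t ≠ 0 → s * t ∈ T) : SemimultiplicativeSet T where
  mul s t := open Classical in
    if h : (s : X) * t ≠ 0 then some ⟨s * t, hT s s.2 t t.2 h⟩ else none
  assoc := by
    intro s t u
    by_cases h1 : (s : X) * t = 0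
    · by_cases h2 : (t : X) * u = 0
      · simp [h1, h2]
      · simp [h1, h2, ← mul_assoc]
    · by_cases h2 : (t : X) * u = 0
      · simp [h1, h2, mul_assoc]
      · by_cases h3 : (s : X) * (t * u) = 0
        · simp [h1, h2, mul_assoc, h3]
        · simp [h1, h2, h3, mul_assoc]

/-! ### The free non-unital `*`-algebra and the degree of words -/

section Free

variable {k X : Type*} (P T : Set X)

/-- The letters `a` and `a*` for `a ∈ P ⊔ T`; the letter `(a, true)` stands for `a*`. -/
abbrev StarLetter : Type _ := (P ⊕ T) × Bool

/-- The non-empty formal words in the letters `a` and `a*`. -/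
abbrev StarWord : Type _ := FreeSemigroup (StarLetter P T)

/-- The free non-unital `*`-algebra on the letter set `P ⊔ T`: the vector space with base all
non-empty words, with the formal product. -/
abbrev FreeStarAlg : Type _ := MonoidAlgebra ℂ (StarWord P T)

variable {P T}

/-- The formal adjoint of a word: reverse the word and replace each letter by its adjoint. -/
def wordStar (w : StarWord P T) : StarWord P T :=
  (FreeSemigroup.lift (fun a : StarLetter P T =>
    MulOpposite.op (FreeSemigroup.of (a.1, !a.2))) w).unop

/-- The formal adjoint on the free `*`-algebra, the conjugate linear extension of `wordStar`. -/
noncomputable def freeStar (x : FreeStarAlg P T) : FreeStarAlg P T :=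
  x.coeff.sum fun w c => MonoidAlgebra.single (wordStar w) (star c)

/-- The degree of a letter: `d(p) = 0`, `d(t)` is the given degree, and `d(a*) = -d(a)`. -/
noncomputable def letterDegree (d : T → (k →₀ ℕ)) : StarLetter P T → (k →₀ ℤ)
  | (.inl _, _) => 0
  | (.inr t, false) => (d t).mapRange Nat.cast Nat.cast_zero
  | (.inr t, true) => -(d t).mapRange Nat.cast Nat.cast_zero

/-- The degree of a word is the sum of the degrees of its letters. -/
noncomputable def wordDegree (d : T → (k →₀ ℕ)) (w : StarWord P T) : k →₀ ℤ :=
  (FreeSemigroup.lift (fun a => Multiplicative.ofAdd (letterDegree d a)) w).toAdd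

/-- The fiber of degree `n`: the linear span of all words of degree `n`. -/
noncomputable def freeFiber (d : T → (k →₀ ℕ)) (n : k →₀ ℤ) : Submodule ℂ (FreeStarAlg P T) :=
  Submodule.span ℂ {x | ∃ w : StarWord P T, wordDegree d w = n ∧ x = MonoidAlgebra.single w 1}

/-- The fiber space: the union of all fibers. -/
noncomputable def fiberSpace (d : T → (k →₀ ℕ)) : Set (FreeStarAlg P T) :=
  ⋃ n : k →₀ ℤ, ((freeFiber d n : Submodule ℂ (FreeStarAlg P T)) : Set (FreeStarAlg P T))

/-- The self-adjoint two-sided ideal of the free `*`-algebra generated by a subset `Y`. -/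
noncomputable def idealGenerated (Y : Set (FreeStarAlg P T)) : Submodule ℂ (FreeStarAlg P T) :=
  sInf {I | Y ⊆ I ∧ (∀ x ∈ I, freeStar x ∈ I) ∧ ∀ x ∈ I, ∀ a, a * x ∈ I ∧ x * a ∈ I}

variable [NonUnitalRing X] [StarRing X] [Module ℂ X] [IsScalarTower ℂ X X] [SMulCommClass ℂ X X]

/-- The element of `X` named by a letter. -/
def letterEval : StarLetter P T → X
  | (.inl p, false) => p
  | (.inl p, true) => star (p : X)
  | (.inr t, false) => t
  | (.inr t, true) => star (t : X)

/-- The element of `X` named by a word. -/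
def wordEval (w : StarWord P T) : X := FreeSemigroup.lift letterEval w

variable (P T) in
/-- The canonical homomorphism from the free `*`-algebra on `P ⊔ T` to `X`. -/
noncomputable def freeEval : FreeStarAlg P T →ₙₐ[ℂ] X :=
  MonoidAlgebra.liftMagma ℂ (FreeSemigroup.lift letterEval)

end Free

/-! ### Semigraph algebras -/

/-- The canonical map from `T₁ = T ⊔ {1}` to the unitization of `X`. -/
def AdjoinUnit.val {X : Type*} [NonUnitalRing X] {T : Set X} :
    AdjoinUnit T → Unitization ℂ X
  | .one => 1
  | .of t => ((t : X) : Unitization ℂ X)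

/-- The structure of a `k`-semigraph algebra on the `*`-algebra `X`. -/
structure SemigraphAlgebra (k X : Type*) [NonUnitalRing X] [StarRing X] [Module ℂ X]
    [IsScalarTower ℂ X X] [SMulCommClass ℂ X X] [StarModule ℂ X] where
  P : Set X
  T : Set X
  disjoint : Disjoint P T
  generates : NonUnitalStarAlgebra.adjoin ℂ (P ∪ T) = ⊤
  /-- `P` is a set of commuting projections closed under multiplication. -/
  isProj : ∀ p ∈ P, p * p = p ∧ star p = p
  P_comm : ∀ p ∈ P, ∀ q ∈ P, p * q = q * p
  P_mul : ∀ p ∈ P, ∀ q ∈ P, p * q ∈ P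
  /-- `T` is a set of nonzero partial isometries closed under nonzero products. -/
  isPartialIsometry : ∀ t ∈ T, t * star t * t = t
  T_ne_zero : ∀ t ∈ T, t ≠ 0
  T_mul : ∀ s ∈ T, ∀ t ∈ T, s * t ≠ 0 → s * t ∈ T
  /-- The degree map of the semigraph `T`. -/
  degree : T → (k →₀ ℕ)
  /-- `T` is a non-unital finitely aligned `k`-semigraph. -/
  semigraph : (nonzeroMul T T_mul).IsNonUnitalFinitelyAlignedSemigraph degree
  skip : ∀ x ∈ T, ∀ p ∈ P, ∃ q ∈ P, p * x = x * q
  /-- `x* y = ∑ α q_{x,y,α,β} β*`, the sum over the (finite) set of minimal common extensions of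
  `x` and `y` in `T₁`; the unit of `T₁` is the unit of the unitization of `X`. -/
  expansion : ∀ x y : T, ∃ q : AdjoinUnit T × AdjoinUnit T → X,
    (∀ a ∈ (nonzeroMul T T_mul).adjoinUnit.minExt
        (SemimultiplicativeSet.adjoinUnitDegree degree) (.of x) (.of y), q a ∈ P) ∧
      ((star (x : X) * (y : X) : X) : Unitization ℂ X) =
        ∑ᶠ a ∈ (nonzeroMul T T_mul).adjoinUnit.minExt
            (SemimultiplicativeSet.adjoinUnitDegree degree) (.of x) (.of y),
          a.1.val * (q a : Unitization ℂ X) * star a.2.val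
  /-- `X` is canonically the quotient of the free `*`-algebra by a subset of the fiber space. -/
  homogeneous : ∃ Y : Set (FreeStarAlg P T), Y ⊆ fiberSpace degree ∧
    ∀ x, freeEval P T x = 0 ↔ x ∈ idealGenerated Y

/-- For a subset `Z` of `X`, the set of all `P_x (1 - P_{y₁}) ⋯ (1 - P_{yₘ})` with `m ≥ 0` and
`x, yᵢ ∈ Z`, where `P_x = x x*`. The product is computed in the unitization of `X`. -/
def refinedProjections {X : Type*} [NonUnitalRing X] [StarRing X] [Module ℂ X]
    [IsScalarTower ℂ X X] [SMulCommClass ℂ X X] (Z : Set X) : Set X :=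
  {e | ∃ x ∈ Z, ∃ l : List X, (∀ y ∈ l, y ∈ Z) ∧
    (e : Unitization ℂ X) = ((x * star x : X) : Unitization ℂ X) *
      (l.map fun y => 1 - ((y * star y : X) : Unitization ℂ X)).prod}

namespace SemigraphAlgebra

variable {k X : Type*} [NonUnitalRing X] [StarRing X] [Module ℂ X]
  [IsScalarTower ℂ X X] [SMulCommClass ℂ X X] [StarModule ℂ X]

/-- The half-standard words: the set `T₁ P` of all `s p` with `s ∈ T₁` and `p ∈ P`. -/
def halfStandardWords (S : SemigraphAlgebra k X) : Set X :=
  {z | ∃ s : AdjoinUnit S.T, ∃ p ∈ S.P, (z : Unitization ℂ X) = s.val * (p : Unitization ℂ X)}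

/-- The standard projections. -/
def standardProjections (S : SemigraphAlgebra k X) : Set X :=
  refinedProjections S.halfStandardWords

/-- The core: the linear span of all words of degree zero. -/
def core (S : SemigraphAlgebra k X) : Submodule ℂ X :=
  Submodule.span ℂ {x | ∃ w : StarWord S.P S.T, wordDegree S.degree w = 0 ∧ x = wordEval w}

end SemigraphAlgebra

/-- A `*`-algebra is a finite dimensional C*-algebra if it is finite dimensional and `*`-isomorphic
to a C*-algebra. -/
def IsFiniteDimensionalCStarAlgebra (A : Type*) [NonUnitalRing A] [StarRing A] [Module ℂ A] :
    Prop :=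
  FiniteDimensional ℂ A ∧
    ∃ (B : Type) (_ : NonUnitalCStarAlgebra B), Nonempty (A ≃⋆ₐ[ℂ] B)

/-- `e` is a finite sum of mutually orthogonal elements of `Z`. -/
def IsFiniteOrthogonalSum {X : Type*} [NonUnitalRing X] (Z : Set X) (e : X) : Prop :=
  ∃ F : Finset X, (∀ f ∈ F, f ∈ Z) ∧ (∀ f ∈ F, ∀ g ∈ F, f ≠ g → f * g = 0) ∧ e = ∑ f ∈ F, f

/-- The `*`-subalgebra `A` has a matrix representation (a `*`-isomorphism with a finite direct sum
of full matrix algebras) whose diagonal projections are finite sums of mutually orthogonal elements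
of `Z`. -/
def HasMatrixRepresentation {X : Type*} [NonUnitalRing X] [StarRing X] [Module ℂ X]
    (A : NonUnitalStarSubalgebra ℂ X) (Z : Set X) : Prop :=
  ∃ (m : ℕ) (n : Fin m → ℕ) (φ : A ≃⋆ₐ[ℂ] (∀ j : Fin m, Matrix (Fin (n j)) (Fin (n j)) ℂ)),
    ∀ (j : Fin m) (i : Fin (n j)),
      IsFiniteOrthogonalSum Z (φ.symm (Pi.single j (Matrix.single i i 1)) : X)

/-! ### Finite orthogonal sums -/

/-! Repeated use of `expansion` and `skip` turns every word into a combination of standard words `s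
p t*` of the same degree, with `s, t ∈ T₁` and `p ∈ P`; the core is therefore spanned by those with
`d(s) = d(t)` (`core_eq_fiber_zero`). The product of `s p t*` and `s' p' t'*` is a sum, over minimal
common extensions `z = tα = s'β`, of words `(sα) r (t'β)*` with `r = (α* p α)(z* z)(β* p' β)`
(`standard_mul`, `word_mul`).

For a fixed degree `n` and projection `p`, the words `s p t*` with `d(s) = d(t) = n` and `p ≤ s*s,
t*t` are matrix units, since `t* s' = 0` for distinct elements of equal degree
(`isMatricial_block`). In a product of two such blocks the degree can only go up, and where it does
not go up the projection can only shrink. Blocks are ordered accordingly, higher degrees being lower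
in the order, so that a product lies in blocks below both factors (`block_mul_block`). A finite
family of blocks closed under products is then assembled from the bottom: the span `V` of the
earlier blocks is an ideal, and a new matrix unit `c` is replaced by `c(1 - u)`, where `u` is the
unit of `V` (`IsMatricial.sup`). The diagonal entries remain orthogonal sums of standard
projections, because such sums are stable under `e ↦ e - ef` (`Refinement.orthogonalSum_sub_mul`).

It remains to enclose finitely many words in a finite closed family, a `Frame`. Finite alignment
keeps the set of words in `T₁` finite (`AlignedClosure.finite`). New projections arise by
conjugation with some `α`; if `α ≠ 1`, this raises the total degree, which is bounded on that finite
set, so only finitely many rounds occur.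

For (b), a nonzero kernel element in a sum of matrix algebras puts a nonzero diagonal matrix unit
into the kernel, and with it a nonzero standard projection below that unit. -/

section OrthogonalSums

variable {X : Type*} [NonUnitalRing X]

/-- The sums of finitely many mutually orthogonal elements of `Z`. -/
inductive OrthogonalSum (Z : Set X) : X → Prop
  | zero : OrthogonalSum Z 0
  | add {e f : X} : OrthogonalSum Z e → f ∈ Z → e * f = 0 → f * e = 0 → OrthogonalSum Z (e + f)

namespace OrthogonalSum

variable {Z Z' : Set X} {e f w : X}

lemma of_mem (hf : f ∈ Z) : OrthogonalSum Z f := by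
  simpa using add zero hf (zero_mul f) (mul_zero f)

lemma mono (h : Z ⊆ Z') (he : OrthogonalSum Z e) : OrthogonalSum Z' e := by
  induction he with
  | zero => exact zero
  | add _ hf h1 h2 ih => exact add ih (h hf) h1 h2

lemma mul_self (hZ : ∀ z ∈ Z, z * z = z) (he : OrthogonalSum Z e) : e * e = e := by
  induction he with
  | zero => simp
  | add _ hf h1 h2 ih => rw [add_mul, mul_add, mul_add, ih, h1, h2, hZ _ hf]; simp

lemma commute (hw : ∀ z ∈ Z, Commute z w) (he : OrthogonalSum Z e) : Commute e w := by
  induction he with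
  | zero => exact Commute.zero_left w
  | add _ hf _ _ ih => exact ih.add_left (hw _ hf)

lemma add_of_orthogonal (hZ : ∀ z ∈ Z, z * z = z) (he : OrthogonalSum Z e)
    (hf : OrthogonalSum Z f) (h1 : e * f = 0) (h2 : f * e = 0) : OrthogonalSum Z (e + f) := by
  induction hf with
  | zero => simpa using he
  | @add f b hf hb hfb hbf ih =>
    have hb2 := hZ b hb
    -- Multiplying by the idempotent `b` isolates the last summand, so orthogonality to the sum
    -- passes to each summand.
    have heb : e * b = 0 := by
      have : e * (f + b) * b = 0 := by rw [h1, zero_mul]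
      rwa [mul_assoc, add_mul, hfb, hb2, zero_add] at this
    have hbe : b * e = 0 := by
      have : b * ((f + b) * e) = 0 := by rw [h2, mul_zero]
      rwa [← mul_assoc, mul_add, hbf, hb2, zero_add] at this
    rw [mul_add, heb, add_zero] at h1
    rw [add_mul, hbe, add_zero] at h2
    rw [← add_assoc]
    exact add (ih h1 h2) hb (by rw [add_mul, heb, hfb, add_zero])
      (by rw [mul_add, hbe, hbf, add_zero])

lemma map (hZ' : ∀ z ∈ Z', z * z = z) (g : X →+ X)
    (hg : ∀ e f, OrthogonalSum Z e → f ∈ Z → e * f = 0 → f * e = 0 →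
      g e * g f = 0 ∧ g f * g e = 0)
    (h : ∀ f ∈ Z, OrthogonalSum Z' (g f)) (he : OrthogonalSum Z e) : OrthogonalSum Z' (g e) := by
  induction he with
  | zero => simpa using zero
  | add he hf h1 h2 ih =>
    rw [map_add]
    exact add_of_orthogonal hZ' ih (h _ hf) (hg _ _ he hf h1 h2).1 (hg _ _ he hf h1 h2).2

lemma mul_right (hZ' : ∀ z ∈ Z', z * z = z) (hw : ∀ z ∈ Z, Commute z w)
    (h : ∀ f ∈ Z, OrthogonalSum Z' (f * w)) (he : OrthogonalSum Z e) :
    OrthogonalSum Z' (e * w) := by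
  refine map hZ' (AddMonoidHom.mulRight w) (fun e f he hf h1 h2 => ?_) h he
  have hew := he.commute hw
  have hfw := hw f hf
  simp only [AddMonoidHom.mulRight_apply]
  constructor
  · rw [mul_assoc, ← mul_assoc w f, ← hfw.eq, mul_assoc f, ← mul_assoc, h1, zero_mul]
  · rw [mul_assoc, ← mul_assoc w e, ← hew.eq, mul_assoc e, ← mul_assoc, h2, zero_mul]

lemma sub_mul_right (hZ' : ∀ z ∈ Z', z * z = z) (hw : ∀ z ∈ Z, Commute z w)
    (h : ∀ f ∈ Z, OrthogonalSum Z' (f - f * w)) (he : OrthogonalSum Z e) :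
    OrthogonalSum Z' (e - e * w) := by
  refine map hZ' (AddMonoidHom.id X - AddMonoidHom.mulRight w) (fun e f he hf h1 h2 => ?_) h he
  have hew := he.commute hw
  have hfw := hw f hf
  simp only [AddMonoidHom.sub_apply, AddMonoidHom.id_apply, AddMonoidHom.mulRight_apply]
  constructor
  · have : e * w * f = 0 := by rw [mul_assoc, ← hfw.eq, ← mul_assoc, h1, zero_mul]
    rw [sub_mul, mul_sub, mul_sub, ← mul_assoc, ← mul_assoc, this, h1]; simp
  · have : f * w * e = 0 := by rw [mul_assoc, ← hew.eq, ← mul_assoc, h2, zero_mul]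
    rw [sub_mul, mul_sub, mul_sub, ← mul_assoc, ← mul_assoc, this, h2]; simp

lemma isFiniteOrthogonalSum (hZ : ∀ z ∈ Z, z * z = z) (he : OrthogonalSum Z e) :
    IsFiniteOrthogonalSum Z e := by
  classical
  induction he with
  | zero => exact ⟨∅, by simp⟩
  | @add e f _ hf h1 h2 ih =>
    obtain ⟨F, hF, hFo, rfl⟩ := ih
    have hl : ∀ a ∈ F, a * ∑ b ∈ F, b = a := fun a ha => by
      rw [Finset.mul_sum, Finset.sum_eq_single_of_mem a ha fun b hb hba => hFo a ha b hb hba.symm,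
        hZ a (hF a ha)]
    have hr : ∀ a ∈ F, (∑ b ∈ F, b) * a = a := fun a ha => by
      rw [Finset.sum_mul, Finset.sum_eq_single_of_mem a ha fun b hb hba => hFo b hb a ha hba,
        hZ a (hF a ha)]
    have haf : ∀ a ∈ F, a * f = 0 := fun a ha => by
      rw [← hl a ha, mul_assoc, h1, mul_zero]
    have hfa : ∀ a ∈ F, f * a = 0 := fun a ha => by
      rw [← hr a ha, ← mul_assoc, h2, zero_mul]
    -- A finite set cannot hold `f` twice; but if `f` already occurs, it is orthogonal to itself and
    -- hence zero.
    by_cases hfF : f ∈ F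
    · have : f = 0 := by rw [← hZ f hf]; exact haf f hfF
      exact ⟨F, hF, hFo, by rw [this, add_zero]⟩
    · refine ⟨insert f F, ?_, ?_, ?_⟩
      · intro a ha
        rcases Finset.mem_insert.1 ha with rfl | ha
        exacts [hf, hF a ha]
      · intro a ha b hb hab
        rcases Finset.mem_insert.1 ha with ha' | ha' <;>
          rcases Finset.mem_insert.1 hb with hb' | hb'
        · exact absurd (ha'.trans hb'.symm) hab
        · rw [ha', hfa b hb']
        · rw [hb', haf a ha']
        · exact hFo a ha' b hb' hab
      · rw [Finset.sum_insert hfF, add_comm]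

/-- Any nonzero summand lies below the whole sum; this brings a nonzero standard projection under a
diagonal matrix unit. -/
lemma exists_ne_zero (hZ : ∀ z ∈ Z, z * z = z) (he : OrthogonalSum Z e) (h0 : e ≠ 0) :
    ∃ f ∈ Z, f ≠ 0 ∧ f * e = f := by
  obtain ⟨F, hF, hFo, rfl⟩ := he.isFiniteOrthogonalSum hZ
  obtain ⟨a, ha, ha0⟩ := Finset.exists_ne_zero_of_sum_ne_zero h0
  refine ⟨a, hF a ha, ha0, ?_⟩
  rw [Finset.mul_sum, Finset.sum_eq_single_of_mem a ha fun b hb hba => hFo a ha b hb hba.symm,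
    hZ a (hF a ha)]

end OrthogonalSum

/-- The elements `z (1 - z₁) ⋯ (1 - zₘ)` with `z, zᵢ ∈ Z`. -/
inductive Refinement (Z : Set X) : X → Prop
  | basic {z : X} : z ∈ Z → Refinement Z z
  | diff {a z : X} : Refinement Z a → z ∈ Z → Refinement Z (a - a * z)

/-- `Z` consists of commuting idempotents whose products are finite orthogonal sums in `Z`. -/
structure IsProjectionFamily (Z : Set X) : Prop where
  comm : ∀ z ∈ Z, ∀ w ∈ Z, Commute z w
  idem : ∀ z ∈ Z, z * z = z
  mul : ∀ z ∈ Z, ∀ w ∈ Z, OrthogonalSum Z (z * w)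

/-! ### Calculus of projections cut down by complements -/

namespace Refinement

variable {Z : Set X} {a b e f w : X}

lemma commute (hw : ∀ z ∈ Z, Commute z w) (ha : Refinement Z a) : Commute a w := by
  induction ha with
  | basic hz => exact hw _ hz
  | diff _ hz ih => exact ih.sub_left (ih.mul_left (hw _ hz))

lemma commute_refinement (H : IsProjectionFamily Z)
    (ha : Refinement Z a) (hb : Refinement Z b) :
    Commute a b :=
  ha.commute fun z hz => (hb.commute fun w hw => H.comm w hw z hz).symm

lemma mul_self (H : IsProjectionFamily Z) (ha : Refinement Z a) : a * a = a := by
  induction ha with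
  | basic hz => exact H.idem _ hz
  | @diff a z ha hz ih =>
    have h : Commute a z := ha.commute fun w hw => H.comm w hw z hz
    have h1 : a * z * a = a * z := by rw [mul_assoc, ← h.eq, ← mul_assoc, ih]
    have h2 : a * z * (a * z) = a * z := by rw [← mul_assoc, h1, mul_assoc, H.idem z hz]
    rw [sub_mul, mul_sub, mul_sub, h1, h2, ← mul_assoc, ih]; simp

lemma orthogonalSum_sub_mul_basic (H : IsProjectionFamily Z)
    (he : OrthogonalSum {a | Refinement Z a} e) (hw : w ∈ Z) :
    OrthogonalSum {a | Refinement Z a} (e - e * w) :=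
  he.sub_mul_right (fun _ h => mul_self H h) (fun _ h => h.commute fun z hz => H.comm z hz w hw)
    fun _ h => .of_mem (diff h hw)

/-- Products of basic elements are controlled by `IsProjectionFamily.mul`; beyond that, `(a - az)w =
aw - (aw)z` reduces to cutting by a complement. -/
lemma orthogonalSum_mul_basic (H : IsProjectionFamily Z)
    (he : OrthogonalSum {a | Refinement Z a} e) (hw : w ∈ Z) :
    OrthogonalSum {a | Refinement Z a} (e * w) := by
  refine he.mul_right (fun _ h => mul_self H h) (fun _ h => h.commute fun z hz => H.comm z hz w hw)
    fun a (ha : Refinement Z a) => ?_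
  induction ha with
  | basic hz => exact (H.mul _ hz w hw).mono fun _ => basic
  | @diff a z ha hz ih =>
    have := orthogonalSum_sub_mul_basic H ih hz
    rwa [mul_assoc, (H.comm w hw z hz).eq, ← mul_assoc, ← sub_mul] at this

/-- The two claims need a joint induction: for `b(1 - z)` in place of `b`, the complement splits
orthogonally as `e(1 - b(1 - z)) = e(1 - b) + ebz`, which uses both claims for `b`. -/
lemma orthogonalSum_mul_and_sub (H : IsProjectionFamily Z)
    (he : OrthogonalSum {a | Refinement Z a} e)
    (hb : Refinement Z b) : OrthogonalSum {a | Refinement Z a} (e * b) ∧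
      OrthogonalSum {a | Refinement Z a} (e - e * b) := by
  induction hb with
  | basic hz =>
    exact ⟨orthogonalSum_mul_basic H he hz, orthogonalSum_sub_mul_basic H he hz⟩
  | @diff b z hb hz ih =>
    have heb : Commute e b := he.commute fun _ h => commute_refinement H h hb
    have hez : Commute e z := he.commute fun _ h => h.commute fun w hw => H.comm w hw z hz
    have he2 : e * e = e := he.mul_self fun _ h => mul_self H h
    have hb2 : b * b = b := mul_self H hb
    have hbz : Commute b z := hb.commute fun w hw => H.comm w hw z hz
    have hebz : e * b * e = e * b := by rw [mul_assoc, ← heb.eq, ← mul_assoc, he2]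
    constructor
    · rw [mul_sub, ← mul_assoc]
      exact orthogonalSum_sub_mul_basic H ih.1 hz
    · have key : e - e * (b - b * z) = (e - e * b) + e * b * z := by
        rw [mul_sub, ← mul_assoc]; abel
      rw [key]
      refine ih.2.add_of_orthogonal (fun _ h => mul_self H h)
        (orthogonalSum_mul_basic H ih.1 hz) ?_ ?_
      · rw [sub_mul, ← mul_assoc, ← mul_assoc, he2, ← mul_assoc, ← mul_assoc, hebz,
          mul_assoc e b b, hb2, sub_self]
      · have : e * b * z = z * (e * b) := (hez.mul_left hbz).eq
        rw [this, mul_sub, mul_assoc z (e * b) e, hebz, mul_assoc z, ← mul_assoc (e * b) e b, hebz,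
          mul_assoc e b b, hb2, sub_self]

/-- For orthogonal `f` and `b` one has `1 - (f + b) = (1 - f)(1 - b)`, so the summands of `f` can be
removed one at a time. -/
lemma orthogonalSum_sub_mul (H : IsProjectionFamily Z)
    (he : OrthogonalSum {a | Refinement Z a} e)
    (hf : OrthogonalSum {a | Refinement Z a} f) :
    OrthogonalSum {a | Refinement Z a} (e - e * f) := by
  induction hf with
  | zero => simpa using he
  | @add f b hf hb h1 h2 ih =>
    have := (orthogonalSum_mul_and_sub H ih hb).2
    rwa [sub_mul, mul_assoc, h1, mul_zero, sub_zero, sub_sub, ← mul_add] at this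

end Refinement

end OrthogonalSums

lemma refinedProjections_eq {X : Type*} [NonUnitalRing X] [StarRing X] [Module ℂ X]
    [IsScalarTower ℂ X X] [SMulCommClass ℂ X X] (Z : Set X) :
    refinedProjections Z = {a | Refinement {e | ∃ x ∈ Z, e = x * star x} a} := by
  ext e
  constructor
  · rintro ⟨x, hx, l, hl, he⟩
    change Refinement _ e
    induction l using List.reverseRecOn generalizing e with
    | nil =>
      have : e = x * star x := Unitization.inr_injective (R := ℂ) (by simpa using he)
      exact .basic ⟨x, hx, this⟩
    | append_singleton l y ih =>
      -- The partial product stays in `X` although the factors `1 - P_y` do not: each factor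
      -- replaces `b` by `b - b P_y`.
      obtain ⟨a, ha⟩ : ∃ a : X, (a : Unitization ℂ X) = ((x * star x : X) : Unitization ℂ X) *
          (l.map fun y => 1 - ((y * star y : X) : Unitization ℂ X)).prod := by
        clear ih hl he
        generalize x * star x = b
        induction l generalizing b with
        | nil => exact ⟨b, by simp⟩
        | cons y l ih =>
          obtain ⟨a, ha⟩ := ih (b - b * (y * star y))
          refine ⟨a, ?_⟩
          rw [ha, List.map_cons, List.prod_cons, ← mul_assoc (b : Unitization ℂ X), mul_sub, mul_one,
            Unitization.inr_sub, Unitization.inr_mul ℂ b]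
      have hra := ih a (fun y hy => hl y (by simp [hy])) ha
      have : e = a - a * (y * star y) := by
        apply Unitization.inr_injective (R := ℂ)
        rw [he, List.map_append, List.prod_append,
          ← mul_assoc ((x * star x : X) : Unitization ℂ X), ← ha, Unitization.inr_sub,
          Unitization.inr_mul ℂ a]
        simp [mul_sub]
      rw [this]
      exact .diff hra ⟨y, hl y (by simp), rfl⟩
  · intro he
    change Refinement _ e at he
    induction he with
    | basic h =>
      obtain ⟨x, hx, rfl⟩ := h
      exact ⟨x, hx, [], by simp, by simp⟩
    | diff _ h ih =>
      obtain ⟨x, hx, l, hl, he⟩ := ih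
      obtain ⟨y, hy, rfl⟩ := h
      refine ⟨x, hx, l ++ [y], ?_, ?_⟩
      · intro z hz
        rcases List.mem_append.1 hz with hz | hz
        · exact hl z hz
        · rw [List.mem_singleton.1 hz]; exact hy
      · rw [List.map_append, List.prod_append,
          ← mul_assoc ((x * star x : X) : Unitization ℂ X), ← he, Unitization.inr_sub,
          Unitization.inr_mul ℂ _ (y * star y)]
        simp [mul_sub]

lemma OrthogonalSum.sum {X : Type*} [NonUnitalRing X] {Z : Set X}
    (hZ : ∀ z ∈ Z, z * z = z) {ι : Type*} (s : Finset ι)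
    (f : ι → X) (hf : ∀ i ∈ s, OrthogonalSum Z (f i))
    (ho : ∀ i ∈ s, ∀ j ∈ s, i ≠ j → f i * f j = 0) : OrthogonalSum Z (∑ i ∈ s, f i) := by
  classical
  induction s using Finset.induction_on with
  | empty => simpa using .zero
  | insert i s hi ih =>
    have hne : ∀ j ∈ s, i ≠ j := fun j hj h => hi (h ▸ hj)
    rw [Finset.sum_insert hi]
    refine (hf i (by simp)).add_of_orthogonal hZ (ih (fun j hj => hf j (by simp [hj]))
      fun j hj l hl => ho j (by simp [hj]) l (by simp [hl])) ?_ ?_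
    · rw [Finset.mul_sum]
      exact Finset.sum_eq_zero fun j hj => ho i (by simp) j (by simp [hj]) (hne j hj)
    · rw [Finset.sum_mul]
      exact Finset.sum_eq_zero fun j hj => ho j (by simp [hj]) i (by simp) (hne j hj).symm

/-! ### Systems of matrix units -/

set_option linter.unusedSectionVars false

/-- A system of matrix units with blocks `j : J` of size `N j`; whole blocks may vanish. -/
structure MatrixUnits (X : Type*) [NonUnitalRing X] [StarRing X] (J : Type*) (N : J → Type*) where
  e : ∀ j, N j → N j → X
  mul_same : ∀ j a b c, e j a b * e j b c = e j a c
  mul_of_ne : ∀ j a b c d, b ≠ c → e j a b * e j c d = 0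
  mul_of_block_ne : ∀ i j, i ≠ j → ∀ a b c d, e i a b * e j c d = 0
  star_eq : ∀ j a b, star (e j a b) = e j b a

namespace MatrixUnits

section Ring

variable {X : Type*} [NonUnitalRing X] [StarRing X] {J : Type*} {N : J → Type*}

/-- The set of all matrix units. -/
def units (E : MatrixUnits X J N) : Set X := {x | ∃ j a b, x = E.e j a b}

lemma finite_units [Finite J] [∀ j, Finite (N j)] (E : MatrixUnits X J N) : E.units.Finite := by
  have : E.units = Set.range fun q : Σ j, N j × N j => E.e q.1 q.2.1 q.2.2 := by
    ext x
    constructor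
    · rintro ⟨j, a, b, rfl⟩
      exact ⟨⟨j, a, b⟩, rfl⟩
    · rintro ⟨⟨j, a, b⟩, rfl⟩
      exact ⟨j, a, b, rfl⟩
  rw [this]
  exact Set.finite_range _

/-- Reindexing a system of matrix units. -/
def reindex (E : MatrixUnits X J N) {J' : Type*} {N' : J' → Type*} (f : J' ↪ J)
    (g : ∀ j, N' j ≃ N (f j)) : MatrixUnits X J' N' where
  e j a b := E.e (f j) (g j a) (g j b)
  mul_same _ _ _ _ := E.mul_same _ _ _ _
  mul_of_ne j _ _ _ _ h := E.mul_of_ne _ _ _ _ _ fun h' => h ((g j).injective h')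
  mul_of_block_ne _ _ h _ _ _ _ := E.mul_of_block_ne _ _ (fun h' => h (f.injective h')) _ _ _ _
  star_eq _ _ _ := E.star_eq _ _ _

/-- The sum of all diagonal matrix units. -/
noncomputable def unit [Fintype J] [∀ j, Fintype (N j)] (E : MatrixUnits X J N) : X :=
  ∑ j, ∑ a, E.e j a a

variable [Fintype J] [∀ j, Fintype (N j)] (E : MatrixUnits X J N)

lemma unit_mul_e (j : J) (a b : N j) : E.unit * E.e j a b = E.e j a b := by
  classical
  rw [unit, Finset.sum_mul, Finset.sum_eq_single j, Finset.sum_mul, Finset.sum_eq_single a,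
    E.mul_same]
  · intro c _ hc; exact E.mul_of_ne _ _ _ _ _ hc
  · simp
  · intro i _ hi
    rw [Finset.sum_mul]
    exact Finset.sum_eq_zero fun c _ => E.mul_of_block_ne _ _ hi _ _ _ _
  · simp

lemma star_unit : star E.unit = E.unit := by simp [unit, E.star_eq]

lemma e_mul_unit (j : J) (a b : N j) : E.e j a b * E.unit = E.e j a b := by
  rw [← star_inj, star_mul, E.star_unit, E.star_eq, E.unit_mul_e]

lemma orthogonalSum_unit {Z : Set X} (hZ : ∀ z ∈ Z, z * z = z)
    (hE : ∀ j a, OrthogonalSum Z (E.e j a a)) : OrthogonalSum Z E.unit := by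
  refine OrthogonalSum.sum hZ _ _ (fun j _ => OrthogonalSum.sum hZ _ _ (fun a _ => hE j a)
    fun a _ b _ hab => E.mul_of_ne _ _ _ _ _ hab) fun i _ j _ hij => ?_
  rw [Finset.sum_mul]
  refine Finset.sum_eq_zero fun a _ => ?_
  rw [Finset.mul_sum]
  exact Finset.sum_eq_zero fun b _ => E.mul_of_block_ne _ _ hij _ _ _ _

end Ring

section Algebra

variable {X : Type*} [NonUnitalRing X] [StarRing X] [Module ℂ X] [IsScalarTower ℂ X X]
  [SMulCommClass ℂ X X] [StarModule ℂ X] {J : Type*} {N : J → Type*}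
  [Fintype J] [∀ j, Fintype (N j)] (E : MatrixUnits X J N)

lemma unit_mem : E.unit ∈ Submodule.span ℂ E.units :=
  Submodule.sum_mem _ fun j _ => Submodule.sum_mem _ fun a _ => Submodule.subset_span ⟨j, a, a, rfl⟩

lemma unit_mul {x : X} (hx : x ∈ Submodule.span ℂ E.units) : E.unit * x = x := by
  induction hx using Submodule.span_induction with
  | mem x h => obtain ⟨j, a, b, rfl⟩ := h; exact E.unit_mul_e j a b
  | zero => simp
  | add x y _ _ hx hy => rw [mul_add, hx, hy]
  | smul c x _ hx => rw [mul_smul_comm, hx]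

lemma mul_unit {x : X} (hx : x ∈ Submodule.span ℂ E.units) : x * E.unit = x := by
  induction hx using Submodule.span_induction with
  | mem x h => obtain ⟨j, a, b, rfl⟩ := h; exact E.e_mul_unit j a b
  | zero => simp
  | add x y _ _ hx hy => rw [add_mul, hx, hy]
  | smul c x _ hx => rw [smul_mul_assoc, hx]

/-- The element of `X` with given matrix coefficients. -/
noncomputable def ofMatrix (M : ∀ j, Matrix (N j) (N j) ℂ) : X :=
  ∑ j, ∑ a, ∑ b, M j a b • E.e j a b

lemma e_mul_ofMatrix (M : ∀ j, Matrix (N j) (N j) ℂ) (j : J) (a b : N j) :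
    E.e j a b * E.ofMatrix M = ∑ d, M j b d • E.e j a d := by
  classical
  rw [ofMatrix, Finset.mul_sum, Finset.sum_eq_single j, Finset.mul_sum, Finset.sum_eq_single b,
    Finset.mul_sum]
  · exact Finset.sum_congr rfl fun d _ => by rw [mul_smul_comm, E.mul_same]
  · intro c _ hc
    rw [Finset.mul_sum]
    exact Finset.sum_eq_zero fun d _ => by
      rw [mul_smul_comm, E.mul_of_ne _ _ _ _ _ hc.symm, smul_zero]
  · simp
  · intro i _ hi
    rw [Finset.mul_sum]
    refine Finset.sum_eq_zero fun c _ => ?_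
    rw [Finset.mul_sum]
    exact Finset.sum_eq_zero fun d _ => by
      rw [mul_smul_comm, E.mul_of_block_ne _ _ hi.symm, smul_zero]
  · simp

lemma e_mul_ofMatrix_mul_e (M : ∀ j, Matrix (N j) (N j) ℂ) (j : J) (a b c d : N j) :
    E.e j a b * E.ofMatrix M * E.e j c d = M j b c • E.e j a d := by
  classical
  rw [e_mul_ofMatrix, Finset.sum_mul, Finset.sum_eq_single c, smul_mul_assoc, E.mul_same]
  · intro i _ hi
    rw [smul_mul_assoc, E.mul_of_ne _ _ _ _ _ hi, smul_zero]
  · simp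

/-- The `*`-homomorphism from a direct sum of matrix algebras given by matrix units. -/
noncomputable def toHom : (∀ j, Matrix (N j) (N j) ℂ) →⋆ₙₐ[ℂ] X where
  toFun := E.ofMatrix
  map_smul' c M := by simp [ofMatrix, Finset.smul_sum, mul_smul]
  map_zero' := by simp [ofMatrix]
  map_add' M M' := by simp [ofMatrix, add_smul, Finset.sum_add_distrib]
  map_mul' M M' := by
    conv_rhs => rw [ofMatrix]
    simp only [Finset.sum_mul, smul_mul_assoc, e_mul_ofMatrix]
    simp only [ofMatrix, Pi.mul_apply, Matrix.mul_apply, Finset.sum_smul, Finset.smul_sum, smul_smul]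
    refine Finset.sum_congr rfl fun j _ => Finset.sum_congr rfl fun a _ => ?_
    exact Finset.sum_comm
  map_star' M := by
    simp only [ofMatrix, star_sum, star_smul, E.star_eq, Pi.star_apply, Matrix.star_apply]
    exact Finset.sum_congr rfl fun j _ => Finset.sum_comm

lemma toHom_single [DecidableEq J] [∀ j, DecidableEq (N j)] (j : J) (a b : N j) :
    E.toHom (Pi.single j (Matrix.single a b 1)) = E.e j a b := by
  change E.ofMatrix _ = _
  rw [ofMatrix, Finset.sum_eq_single j, Finset.sum_eq_single a, Finset.sum_eq_single b]
  · simp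
  · intro d _ hd; simp [hd.symm]
  · simp
  · intro c _ hc; exact Finset.sum_eq_zero fun d _ => by simp [hc.symm]
  · simp
  · intro i _ hi
    exact Finset.sum_eq_zero fun c _ => Finset.sum_eq_zero fun d _ => by simp [hi]
  · simp

lemma mem_span_units_iff {x : X} : x ∈ Submodule.span ℂ E.units ↔ ∃ M, E.ofMatrix M = x := by
  classical
  constructor
  · intro hx
    induction hx using Submodule.span_induction with
    | mem x h => obtain ⟨j, a, b, rfl⟩ := h; exact ⟨_, E.toHom_single j a b⟩
    | zero => exact ⟨0, map_zero E.toHom⟩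
    | add x y _ _ hx hy =>
      obtain ⟨M, rfl⟩ := hx
      obtain ⟨M', rfl⟩ := hy
      exact ⟨M + M', map_add E.toHom M M'⟩
    | smul c x _ hx =>
      obtain ⟨M, rfl⟩ := hx
      exact ⟨c • M, map_smul E.toHom c M⟩
  · rintro ⟨M, rfl⟩
    exact Submodule.sum_mem _ fun j _ => Submodule.sum_mem _ fun a _ => Submodule.sum_mem _
      fun b _ => Submodule.smul_mem _ _ (Submodule.subset_span ⟨j, a, b, rfl⟩)

/-- Compression between two diagonal matrix units isolates one coefficient, so nonvanishing of the
units already gives linear independence. -/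
lemma toHom_injective (h : ∀ j a b, E.e j a b ≠ 0) : Function.Injective E.toHom := by
  rw [injective_iff_map_eq_zero]
  intro M hM
  ext j a b
  have := E.e_mul_ofMatrix_mul_e M j a a b b
  rw [show E.ofMatrix M = 0 from hM, mul_zero, zero_mul] at this
  exact (smul_eq_zero.1 this.symm).resolve_right (h j a b)

/-- The nonzero blocks of a system of matrix units. -/
lemma exists_nonzero_fin :
    ∃ (m : ℕ) (n : Fin m → ℕ) (E' : MatrixUnits X (Fin m) fun j => Fin (n j)),
      (∀ j a b, E'.e j a b ≠ 0) ∧ Submodule.span ℂ E'.units = Submodule.span ℂ E.units ∧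
      ∀ j a, ∃ j' a', E'.e j a a = E.e j' a' a' := by
  classical
  let J' := {j : J // ∃ a b, E.e j a b ≠ 0}
  let f : Fin (Fintype.card J') ↪ J :=
    (Fintype.equivFin J').symm.toEmbedding.trans (Function.Embedding.subtype _)
  have hf : ∀ i, ∃ a b, E.e (f i) a b ≠ 0 := fun i => ((Fintype.equivFin J').symm i).2
  refine ⟨Fintype.card J', fun j => Fintype.card (N (f j)),
    E.reindex f fun j => (Fintype.equivFin _).symm, ?_, ?_, fun j a => ⟨_, _, rfl⟩⟩
  · intro j a b h0
    obtain ⟨c, d, hcd⟩ := hf j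
    refine hcd ?_
    have h0 : E.e (f j) ((Fintype.equivFin _).symm a) ((Fintype.equivFin _).symm b) = 0 := h0
    -- Since `e_cd = e_ca e_ab e_bd`, one vanishing unit makes its whole block vanish.
    rw [← E.mul_same _ c ((Fintype.equivFin _).symm a) d,
      ← E.mul_same _ _ ((Fintype.equivFin _).symm b) d, h0, zero_mul, mul_zero]
  · apply le_antisymm
    · rw [Submodule.span_le]
      rintro x ⟨j, a, b, rfl⟩
      exact Submodule.subset_span ⟨_, _, _, rfl⟩
    · rw [Submodule.span_le]
      rintro x ⟨j, a, b, rfl⟩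
      by_cases h : E.e j a b = 0
      · rw [h]; exact Submodule.zero_mem _
      · obtain ⟨i, rfl⟩ : ∃ i, f i = j :=
          ⟨Fintype.equivFin J' ⟨j, a, b, h⟩, congrArg Subtype.val
            ((Fintype.equivFin J').symm_apply_apply ⟨j, a, b, h⟩)⟩
        exact Submodule.subset_span
          ⟨i, Fintype.equivFin _ a, Fintype.equivFin _ b, by simp [reindex]⟩

end Algebra

end MatrixUnits

/-- The subspace `V` is spanned by a finite system of matrix units with diagonal in `D`. -/
def IsMatricial {X : Type*} [NonUnitalRing X] [StarRing X] [Module ℂ X] (D : X → Prop)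
    (V : Submodule ℂ X) : Prop :=
  ∃ (m : ℕ) (n : Fin m → ℕ) (E : MatrixUnits X (Fin m) fun j => Fin (n j)),
    (∀ j a b, E.e j a b ≠ 0) ∧ (∀ j a, D (E.e j a a)) ∧ V = Submodule.span ℂ E.units

/-! ### Subspaces spanned by matrix units -/

namespace IsMatricial

variable {X : Type*} [NonUnitalRing X] [StarRing X] [Module ℂ X] [IsScalarTower ℂ X X]
  [SMulCommClass ℂ X X] [StarModule ℂ X] {D : X → Prop} {V : Submodule ℂ X}

lemma of_matrixUnits {J : Type*} {N : J → Type*} [Finite J] [∀ j, Finite (N j)]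
    (E : MatrixUnits X J N) (hE : ∀ j a, D (E.e j a a)) :
    IsMatricial D (Submodule.span ℂ E.units) := by
  have := Fintype.ofFinite J
  have := fun j => Fintype.ofFinite (N j)
  obtain ⟨m, n, E', h0, hs, hd⟩ := E.exists_nonzero_fin
  refine ⟨m, n, E', h0, fun j a => ?_, hs.symm⟩
  obtain ⟨j', a', h⟩ := hd j a
  rw [h]
  exact hE _ _

lemma bot : IsMatricial D (⊥ : Submodule ℂ X) := by
  refine ⟨0, Fin.elim0, ⟨fun j => j.elim0, fun j => j.elim0, fun j => j.elim0, fun j => j.elim0,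
    fun j => j.elim0⟩, fun j => j.elim0, fun j => j.elim0, ?_⟩
  symm
  rw [Submodule.span_eq_bot]
  rintro x ⟨j, _⟩
  exact j.elim0

/-- If `V` is an ideal in `V + C` then the matrix units of `C`, cut down by the complement of the
unit of `V`, complete the matrix units of `V`. -/
lemma sup {Z : Set X} (hZ : ∀ z ∈ Z, z * z = z)
    (hsub : ∀ e f, OrthogonalSum Z e → OrthogonalSum Z f → OrthogonalSum Z (e - e * f))
    {C : Submodule ℂ X} (hV : IsMatricial (OrthogonalSum Z) V)
    (hC : IsMatricial (OrthogonalSum Z) C) (hl : ∀ c ∈ C, ∀ v ∈ V, c * v ∈ V)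
    (hr : ∀ c ∈ C, ∀ v ∈ V, v * c ∈ V) : IsMatricial (OrthogonalSum Z) (V ⊔ C) := by
  obtain ⟨m, n, E, -, hE, rfl⟩ := hV
  obtain ⟨m', n', E', -, hE', rfl⟩ := hC
  set u := E.unit
  -- Both `uc` and `cu` lie in `V`, where `u` is a two-sided unit, so `uc = ucu = cu`.
  have hcomm : ∀ c ∈ Submodule.span ℂ E'.units, u * c = c * u := fun c hc => by
    rw [← E.unit_mul (hl c hc u E.unit_mem), ← mul_assoc, E.mul_unit (hr c hc u E.unit_mem)]
  have hu2 : u * u = u := E.unit_mul E.unit_mem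
  have hmem : ∀ j a b, E'.e j a b ∈ Submodule.span ℂ E'.units := fun j a b =>
    Submodule.subset_span ⟨j, a, b, rfl⟩
  have hcut : ∀ c ∈ Submodule.span ℂ E'.units, ∀ c' ∈ Submodule.span ℂ E'.units,
      (c - c * u) * (c' - c' * u) = c * c' - c * c' * u := fun c _ c' hc' => by
    have : c * u * c' * u = c * u * c' := by
      rw [mul_assoc, ← hcomm c' hc', ← mul_assoc, mul_assoc c u u, hu2]
    rw [sub_mul, mul_sub, mul_sub, ← mul_assoc, ← mul_assoc, this, sub_self, sub_zero]
  have hcut_same : ∀ j a b c, (E'.e j a b - E'.e j a b * u) * (E'.e j b c - E'.e j b c * u) =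
      E'.e j a c - E'.e j a c * u := fun j a b c => by
    rw [hcut _ (hmem _ _ _) _ (hmem _ _ _), E'.mul_same]
  have hcut_ne : ∀ i j a b c d, E'.e i a b * E'.e j c d = 0 →
      (E'.e i a b - E'.e i a b * u) * (E'.e j c d - E'.e j c d * u) = 0 :=
    fun i j a b c d h => by
      rw [hcut _ (hmem _ _ _) _ (hmem _ _ _), h, zero_mul, sub_zero]
  have hcut_star : ∀ j a b, star (E'.e j a b - E'.e j a b * u) = E'.e j b a - E'.e j b a * u :=
    fun j a b => by
      rw [star_sub, star_mul, E'.star_eq, E.star_unit, hcomm _ (hmem _ _ _)]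
  have hzero : ∀ j a b, ∀ c ∈ Submodule.span ℂ E'.units, E.e j a b * (c - c * u) = 0 :=
    fun j a b c hc => by
      rw [mul_sub, ← hcomm c hc, ← mul_assoc, E.e_mul_unit, sub_self]
  have hzero' : ∀ j a b, ∀ c ∈ Submodule.span ℂ E'.units, (c - c * u) * E.e j a b = 0 :=
    fun j a b c hc => by
      rw [sub_mul, mul_assoc, E.unit_mul_e, sub_self]
  -- As `u` is an idempotent commuting with the second space, `c ↦ c - cu` is multiplicative and
  -- `*`-preserving there, and its values annihilate `V`. The two systems are thus mutually
  -- orthogonal; blocks that become zero are harmless.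
  let F : MatrixUnits X (Fin m ⊕ Fin m') (Sum.elim (fun j => Fin (n j)) fun j => Fin (n' j)) :=
    { e := fun j => match j with
        | .inl j => fun a b => E.e j a b
        | .inr j => fun a b => E'.e j a b - E'.e j a b * u
      mul_same := by
        rintro (j | j) a b c
        · exact E.mul_same j a b c
        · exact hcut_same j a b c
      mul_of_ne := by
        rintro (j | j) a b c d h
        · exact E.mul_of_ne j a b c d h
        · exact hcut_ne j j a b c d (E'.mul_of_ne _ _ _ _ _ h)
      mul_of_block_ne := by
        rintro (i | i) (j | j) h a b c d
        · exact E.mul_of_block_ne i j (fun h' => h (by rw [h'])) a b c d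
        · exact hzero _ _ _ _ (hmem _ _ _)
        · exact hzero' _ _ _ _ (hmem _ _ _)
        · exact hcut_ne i j a b c d
            (E'.mul_of_block_ne i j (fun h' => h (by rw [h'])) a b c d)
      star_eq := by
        rintro (j | j) a b
        · exact E.star_eq j a b
        · exact hcut_star j a b }
  have hfin : ∀ j, Finite (Sum.elim (fun j => Fin (n j)) (fun j => Fin (n' j)) j) := by
    rintro (j | j)
    · exact inferInstanceAs (Finite (Fin (n j)))
    · exact inferInstanceAs (Finite (Fin (n' j)))
  have hF := of_matrixUnits (D := OrthogonalSum Z) F (by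
    rintro (j | j) a
    · exact hE j a
    · exact hsub _ _ (hE' j a) (E.orthogonalSum_unit hZ hE))
  convert hF using 1
  have hEF : Submodule.span ℂ E.units ≤ Submodule.span ℂ F.units := by
    rw [Submodule.span_le]
    rintro x ⟨j, a, b, rfl⟩
    exact Submodule.subset_span ⟨.inl j, a, b, rfl⟩
  apply le_antisymm
  · refine sup_le hEF ?_
    rw [Submodule.span_le]
    rintro x ⟨j, a, b, rfl⟩
    rw [← sub_add_cancel (E'.e j a b) (E'.e j a b * u)]
    exact Submodule.add_mem _ (Submodule.subset_span ⟨.inr j, a, b, rfl⟩)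
      (hEF (hl _ (hmem _ _ _) _ E.unit_mem))
  · rw [Submodule.span_le]
    rintro x ⟨j | j, a, b, rfl⟩
    · exact Submodule.mem_sup_left (Submodule.subset_span ⟨j, a, b, rfl⟩)
    · exact Submodule.sub_mem _ (Submodule.mem_sup_right (hmem _ _ _))
        (Submodule.mem_sup_left (hl _ (hmem _ _ _) _ E.unit_mem))

/-- A sum of matricial blocks indexed by a finite poset, such that the product of two blocks lies
in the sum of the blocks below both, is matricial. -/
lemma iSup {Z : Set X} (hZ : ∀ z ∈ Z, z * z = z)
    (hsub : ∀ e f, OrthogonalSum Z e → OrthogonalSum Z f → OrthogonalSum Z (e - e * f))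
    {ι : Type*} [PartialOrder ι] (W : Finset ι) (C : ι → Submodule ℂ X)
    (hC : ∀ i ∈ W, IsMatricial (OrthogonalSum Z) (C i))
    (hmul : ∀ i ∈ W, ∀ j ∈ W, ∀ x ∈ C i, ∀ y ∈ C j,
      x * y ∈ ⨆ (l : ι) (_ : l ∈ W ∧ l ≤ i ∧ l ≤ j), C l) :
    IsMatricial (OrthogonalSum Z) (⨆ i ∈ W, C i) := by
  classical
  -- The induction runs over the lower subsets of `W`, detaching a maximal element each time.
  suffices H : ∀ (r : ℕ) (U : Finset ι), U.card = r → U ⊆ W →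
      (∀ i ∈ U, ∀ l ∈ W, l ≤ i → l ∈ U) → IsMatricial (OrthogonalSum Z) (⨆ i ∈ U, C i) from
    H _ W rfl subset_rfl fun _ _ _ h _ => h
  intro r
  induction r with
  | zero =>
    intro U hU _ _
    rw [Finset.card_eq_zero] at hU
    subst hU
    simpa using bot
  | succ r ih =>
    intro U hU hUW hlow
    obtain ⟨i, hi⟩ := U.exists_maximal (Finset.card_pos.1 (by omega))
    have hiU := hi.prop
    have hne : ∀ j ∈ U.erase i, ¬ i ≤ j := fun j hj hij =>
      (Finset.mem_erase.1 hj).1 (hi.eq_of_le (Finset.mem_of_mem_erase hj) hij).symm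
    have hsup : (⨆ j ∈ U, C j) = (⨆ j ∈ U.erase i, C j) ⊔ C i := by
      conv_lhs => rw [← Finset.insert_erase hiU]
      rw [Finset.iSup_insert, sup_comm]
    -- A block below both `i` and `j` is never the block `i` itself, by maximality of `i`. Hence the
    -- sum of the remaining blocks is an ideal.
    have key : ∀ j ∈ U.erase i, (⨆ (l : ι) (_ : l ∈ W ∧ l ≤ i ∧ l ≤ j), C l) ≤
        ⨆ j ∈ U.erase i, C j := by
      intro j hj
      refine iSup₂_le fun l hl => ?_
      refine le_iSup₂_of_le l (Finset.mem_erase.2 ⟨?_, hlow i hiU l hl.1 hl.2.1⟩) le_rfl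
      rintro rfl
      exact hne j hj hl.2.2
    rw [hsup]
    refine sup hZ hsub (ih _ (by rw [Finset.card_erase_of_mem hiU]; omega)
      ((Finset.erase_subset _ _).trans hUW) fun j hj l hl hlj => ?_) (hC i (hUW hiU)) ?_ ?_
    · refine Finset.mem_erase.2 ⟨?_, hlow j (Finset.mem_of_mem_erase hj) l hl hlj⟩
      rintro rfl
      exact hne j hj hlj
    · intro c hc v hv
      have : (⨆ j ∈ U.erase i, C j) ≤ (⨆ j ∈ U.erase i, C j).comap (LinearMap.mulLeft ℂ c) :=
        iSup₂_le fun j hj y hy =>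
          key j hj (hmul i (hUW hiU) j (hUW (Finset.mem_of_mem_erase hj)) c hc y hy)
      exact this hv
    · intro c hc v hv
      have : (⨆ j ∈ U.erase i, C j) ≤ (⨆ j ∈ U.erase i, C j).comap (LinearMap.mulRight ℂ c) :=
        iSup₂_le fun j hj y hy => by
          have := hmul j (hUW (Finset.mem_of_mem_erase hj)) i (hUW hiU) y hy c hc
          simp only [@and_comm (_ ≤ j)] at this
          exact key j hj this
      exact this hv

/-- The `*`-subalgebra underlying a matricial subspace, with its matrix representation. -/
lemma exists_subalgebra {Z : Set X} (hZ : ∀ z ∈ Z, z * z = z)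
    (hV : IsMatricial (OrthogonalSum Z) V) : ∃ A : NonUnitalStarSubalgebra ℂ X,
      (A : Set X) = V ∧ HasMatrixRepresentation A Z := by
  obtain ⟨m, n, E, h0, hE, rfl⟩ := hV
  refine ⟨NonUnitalStarAlgHom.range E.toHom, ?_, m, n,
    (StarAlgEquiv.ofInjective' E.toHom (E.toHom_injective h0)).symm, fun j a => ?_⟩
  · ext x
    rw [SetLike.mem_coe, SetLike.mem_coe, E.mem_span_units_iff]
    exact NonUnitalStarAlgHom.mem_range _
  · have : (((StarAlgEquiv.ofInjective' E.toHom (E.toHom_injective h0)).symm.symm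
        (Pi.single j (Matrix.single a a 1)) : NonUnitalStarAlgHom.range E.toHom) : X) =
        E.e j a a := E.toHom_single j a a
    rw [this]
    exact (hE j a).isFiniteOrthogonalSum hZ

/-- A `*`-homomorphism which does not vanish on the nonzero elements of `Z` is injective on
matricial subspaces. -/
lemma eq_zero_of_map_eq_zero {Z : Set X} (hZ : ∀ z ∈ Z, z * z = z)
    (hV : IsMatricial (OrthogonalSum Z) V) {B : Type*} [NonUnitalRing B] [Module ℂ B]
    [StarRing B] (π : X →⋆ₙₐ[ℂ] B) (hπ : ∀ z ∈ Z, z ≠ 0 → π z ≠ 0) {x : X} (hx : x ∈ V)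
    (h : π x = 0) : x = 0 := by
  obtain ⟨m, n, E, h0, hE, rfl⟩ := hV
  obtain ⟨M, rfl⟩ := E.mem_span_units_iff.1 hx
  suffices M = 0 by rw [this]; exact map_zero E.toHom
  ext j a b
  by_contra hne
  -- Compression: `e_aa x e_ba = M_ab e_aa`, so a nonzero coefficient forces `π` to kill `e_aa`.
  have h1 : π (M j a b • E.e j a a) = 0 := by
    rw [← E.e_mul_ofMatrix_mul_e M j a a b a, map_mul, map_mul, h, mul_zero, zero_mul]
  have h2 : π (E.e j a a) = 0 := by
    have : E.e j a a = (M j a b)⁻¹ • M j a b • E.e j a a := by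
      rw [smul_smul, inv_mul_cancel₀ hne, one_smul]
    rw [this, map_smul, h1, smul_zero]
  obtain ⟨f, hf, hf0, hfe⟩ := (hE j a).exists_ne_zero hZ (h0 j a a)
  exact hπ f hf hf0 (by rw [← hfe, map_mul, h2, mul_zero])

end IsMatricial

open scoped ComplexOrder in
/-- A `*`-algebra with a matrix representation is a finite dimensional C*-algebra. -/
lemma HasMatrixRepresentation.isFiniteDimensionalCStarAlgebra {X : Type*} [NonUnitalRing X]
    [StarRing X] [Module ℂ X] {A : NonUnitalStarSubalgebra ℂ X} {Z : Set X}
    (h : HasMatrixRepresentation A Z) : IsFiniteDimensionalCStarAlgebra A := by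
  obtain ⟨m, n, φ, -⟩ := h
  let φₗ : A ≃ₗ[ℂ] (∀ j : Fin m, Matrix (Fin (n j)) (Fin (n j)) ℂ) :=
    { φ with map_smul' := map_smul φ }
  refine ⟨φₗ.symm.finiteDimensional, ∀ j : Fin m, CStarMatrix (Fin (n j)) (Fin (n j)) ℂ,
    inferInstance, ⟨φ.trans
      { toFun := fun M j => CStarMatrix.ofMatrix (M j)
        invFun := fun M j => CStarMatrix.ofMatrix.symm (M j)
        left_inv := fun _ => rfl
        right_inv := fun _ => rfl
        map_mul' := fun _ _ => rfl
        map_add' := fun _ _ => rfl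
        map_star' := fun _ => rfl
        map_smul' := fun _ _ => rfl }⟩⟩

/-! ### Unital semigraphs -/

namespace SemimultiplicativeSet

variable {k G : Type*} {M : SemimultiplicativeSet G} {d : G → (k →₀ ℕ)} {one : G}

/-- `M` is a semigraph with unit `one`. -/
structure IsUnitalSemigraph (M : SemimultiplicativeSet G) (d : G → (k →₀ ℕ)) (one : G) : Prop
    extends M.IsSemigraph d where
  one_mul : ∀ x, M.mul one x = some x
  mul_one : ∀ x, M.mul x one = some x

lemma mul_of_mul_left {a b c e f : G} (h1 : M.mul a b = some c) (h2 : M.mul c e = some f) :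
    ∃ g, M.mul b e = some g ∧ M.mul a g = some f := by
  have h := M.assoc a b e
  rw [h1, Option.bind_some, h2] at h
  exact Option.bind_eq_some_iff.1 h.symm

lemma mul_of_mul_right {a b e f g : G} (h1 : M.mul b e = some g) (h2 : M.mul a g = some f) :
    ∃ c, M.mul a b = some c ∧ M.mul c e = some f := by
  have h := M.assoc a b e
  rw [h1, Option.bind_some, h2] at h
  exact Option.bind_eq_some_iff.1 h

namespace IsUnitalSemigraph

lemma degree_one (H : M.IsUnitalSemigraph d one) : d one = 0 := by
  have := H.degree_mul _ _ _ (H.one_mul one)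
  simpa using this

lemma factor_unique (H : M.IsUnitalSemigraph d one) {a b a' b' z : G} (h : M.mul a b = some z)
    (h' : M.mul a' b' = some z) (hd : d a = d a') : a = a' ∧ b = b' := by
  have h1 := H.degree_mul _ _ _ h
  have h2 := H.degree_mul _ _ _ h'
  have h3 : d b' = d b := by
    rw [h1, hd] at h2
    exact (add_left_cancel h2).symm
  have := (H.factorisation z (d a) (d b) h1).unique (y₁ := (a, b)) (y₂ := (a', b'))
    ⟨h, rfl, rfl⟩ ⟨h', hd.symm, h3⟩
  exact Prod.ext_iff.1 this

lemma left_cancel (H : M.IsUnitalSemigraph d one) {x a b z : G} (h : M.mul x a = some z)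
    (h' : M.mul x b = some z) : a = b := (H.factor_unique h h' rfl).2

/-- Both `x·1` and `1·x` are factorisations of `x` whose first factor has degree zero; uniqueness
identifies the first factors. -/
lemma eq_one (H : M.IsUnitalSemigraph d one) {x : G} (h : d x = 0) : x = one :=
  (H.factor_unique (H.mul_one x) (H.one_mul x) (h.trans H.degree_one.symm)).1

lemma eq_of_degree_eq (H : M.IsUnitalSemigraph d one) {x a z : G} (h : M.mul x a = some z)
    (hd : d z = d x) : a = one ∧ z = x := by
  have h1 := H.degree_mul _ _ _ h
  rw [hd] at h1
  obtain rfl := H.eq_one (x := a) (by simpa using h1)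
  rw [H.mul_one] at h
  exact ⟨rfl, (Option.some_injective _ h).symm⟩

lemma degree_le (H : M.IsUnitalSemigraph d one) {x a z : G} (h : M.mul x a = some z) :
    d x ≤ d z := by
  rw [H.degree_mul _ _ _ h]; exact le_self_add

lemma exists_factor (H : M.IsUnitalSemigraph d one) (z : G) {n : k →₀ ℕ} (hn : n ≤ d z) :
    ∃ a b, M.mul a b = some z ∧ d a = n := by
  obtain ⟨⟨a, b⟩, ⟨h, hd, -⟩, -⟩ :=
    H.factorisation z n (d z - n) (add_tsub_cancel_of_le hn).symm
  exact ⟨a, b, h, hd⟩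

/-- The initial piece of `y` of degree `d t` is also an initial piece of `x`, so unique
factorisation identifies it with `t`. -/
lemma exists_factor_left (H : M.IsUnitalSemigraph d one) {t γ x y ζ : G}
    (h : M.mul t γ = some x) (hy : M.mul y ζ = some x) (hd : d t ≤ d y) :
    ∃ ε, M.mul t ε = some y ∧ M.mul ε ζ = some γ := by
  obtain ⟨t', ε, ht', hdt'⟩ := H.exists_factor y hd
  obtain ⟨g, hg, hg'⟩ := mul_of_mul_left ht' hy
  obtain ⟨rfl, rfl⟩ := H.factor_unique hg' h hdt'
  exact ⟨ε, ht', hg⟩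

/-- Every common extension factors through a minimal one. -/
lemma exists_minExt (H : M.IsUnitalSemigraph d one) {t γ s δ x : G} (h : M.mul t γ = some x)
    (h' : M.mul s δ = some x) : ∃ ε ε' ζ y, M.mul t ε = some y ∧ M.mul s ε' = some y ∧
      d y = d t ⊔ d s ∧ M.mul ε ζ = some γ ∧ M.mul ε' ζ = some δ ∧ M.mul y ζ = some x := by
  obtain ⟨y, ζ, hy, hdy⟩ := H.exists_factor x (sup_le (H.degree_le h) (H.degree_le h'))
  obtain ⟨ε, h1, h2⟩ := H.exists_factor_left h hy (hdy ▸ le_sup_left)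
  obtain ⟨ε', h3, h4⟩ := H.exists_factor_left h' hy (hdy ▸ le_sup_right)
  exact ⟨ε, ε', ζ, y, h1, h3, hdy, h2, h4, hy⟩

end IsUnitalSemigraph

/-- The smallest set containing `F` and closed under replacing the initial part `t` of a minimal
common extension of `t` and `x` by an element `s` of the same degree. -/
inductive AlignedClosure (M : SemimultiplicativeSet G) (d : G → (k →₀ ℕ)) (F : Set G) : G → Prop
  | base {x : G} : x ∈ F → AlignedClosure M d F x
  | step {s t x y z γ γ' : G} : AlignedClosure M d F s → AlignedClosure M d F t →
      AlignedClosure M d F x → d s = d t → M.mul t γ = some z → M.mul x γ' = some z →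
      d z = d t ⊔ d x → M.mul s γ = some y → AlignedClosure M d F y

/-! ### Finiteness of the aligned closure -/

namespace AlignedClosure

variable {F : Set G}

lemma degree_step (H : M.IsUnitalSemigraph d one) {s t y z γ : G} (h : d s = d t)
    (hz : M.mul t γ = some z) (hy : M.mul s γ = some y) : d y = d z := by
  rw [H.degree_mul _ _ _ hz, H.degree_mul _ _ _ hy, h]

lemma degree_le (H : M.IsUnitalSemigraph d one) {N : k →₀ ℕ} (hN : ∀ x ∈ F, d x ≤ N) {x : G}
    (hx : AlignedClosure M d F x) : d x ≤ N := by
  induction hx with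
  | base h => exact hN _ h
  | step _ _ _ hd hz _ hdz hy _ iht ihx =>
    rw [degree_step H hd hz hy, hdz]
    exact sup_le iht ihx

/-- Strong induction on the degree. Given the finite set `L` of closure elements of smaller degree,
`E` collects the generators and the results of steps with all inputs in `L`, which are finitely many
by finite alignment. `R` allows one further exchange of an initial piece. A second exchange brings
nothing new, because two successive exchanges merge into one. -/
lemma finite_degree_eq (H : M.IsUnitalSemigraph d one) (hM : M.FinitelyAligned d) (hF : F.Finite)
    (n : k →₀ ℕ) : {x | AlignedClosure M d F x ∧ d x = n}.Finite := by
  induction n using WellFoundedLT.induction with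
  | ind n ih =>
  let L : Set G := {x | AlignedClosure M d F x ∧ d x < n}
  have hL : L.Finite := by
    have : L = ⋃ m ∈ Set.Iio n, {x | AlignedClosure M d F x ∧ d x = m} := by
      ext x
      simp [L, and_comm]
    rw [this]
    classical
    exact ((Set.finite_Icc 0 n).subset fun m hm => ⟨zero_le, le_of_lt hm⟩).biUnion
      fun m hm => ih m hm
  let E : Set G := F ∪ ⋃ s ∈ L, ⋃ t ∈ L, ⋃ x ∈ L, ⋃ a ∈ M.minExt d t x, {y | M.mul s a.1 = some y}
  have hE : E.Finite := by
    refine hF.union (hL.biUnion fun s _ => hL.biUnion fun t _ => hL.biUnion fun x _ =>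
      (hM t x).biUnion fun a _ => Set.Subsingleton.finite ?_)
    intro y hy y' hy'
    exact Option.some_injective _ (hy.symm.trans hy')
  have hEmem : ∀ {s t x z y γ γ'}, s ∈ L → t ∈ L → x ∈ L → M.mul t γ = some z →
      M.mul x γ' = some z → d z = d t ⊔ d x → M.mul s γ = some y → y ∈ E := by
    intro s t x z y γ γ' hs ht hx h1 h2 h3 h4
    refine Or.inr ?_
    simp only [Set.mem_iUnion]
    exact ⟨s, hs, t, ht, x, hx, (γ, γ'), ⟨z, h1, h2, h3⟩, h4⟩
  let R : Set G := E ∪ ⋃ s ∈ L, ⋃ t ∈ L, ⋃ x ∈ E,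
    {y | ∃ γ, d s = d t ∧ M.mul t γ = some x ∧ M.mul s γ = some y}
  have hR : R.Finite := by
    refine hE.union (hL.biUnion fun s _ => hL.biUnion fun t _ => hE.biUnion fun x _ =>
      Set.Subsingleton.finite ?_)
    rintro y ⟨γ, -, h1, h2⟩ y' ⟨γ', -, h1', h2'⟩
    obtain rfl := H.left_cancel h1 h1'
    exact Option.some_injective _ (h2.symm.trans h2')
  have hRmem : ∀ {s t x y γ}, s ∈ L → t ∈ L → x ∈ E → d s = d t → M.mul t γ = some x →
      M.mul s γ = some y → y ∈ R := by
    intro s t x y γ hs ht hx h1 h2 h3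
    refine Or.inr ?_
    simp only [Set.mem_iUnion]
    exact ⟨s, hs, t, ht, x, hx, γ, h1, h2, h3⟩
  refine hR.subset ?_
  rintro y ⟨hy, hyn⟩
  induction hy with
  | base h => exact Or.inl (Or.inl h)
  | @step s t x y z γ γ' hs ht hx hd hz hz' hdz hy ihs iht ihx =>
    have hzn : d z = n := (degree_step H hd hz hy).symm.trans hyn
    have htn : d t ≤ n := hzn ▸ H.degree_le hz
    have hxn : d x ≤ n := hzn ▸ H.degree_le hz'
    -- If `t` already has degree `n`, then `γ = 1` and the step merely returns `s`.
    rcases htn.eq_or_lt with htn | htn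
    · obtain ⟨-, rfl⟩ := H.eq_of_degree_eq hy (hyn.trans (htn.symm.trans hd.symm))
      exact ihs hyn
    have htL : t ∈ L := ⟨ht, htn⟩
    have hsL : s ∈ L := ⟨hs, show d s < n from hd ▸ htn⟩
    rcases hxn.eq_or_lt with hxn | hxn
    · obtain ⟨rfl, rfl⟩ := H.eq_of_degree_eq hz' (hzn.trans hxn.symm)
      rcases ihx hxn with hzE | hzE
      · exact hRmem hsL htL hzE hd hz hy
      · simp only [Set.mem_iUnion] at hzE
        obtain ⟨s₂, hs₂, t₂, ht₂, w, hw, δ, hd₂, hwδ, hzδ⟩ := hzE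
        -- Here `y` comes from `w ∈ E` by exchanging `t₂` for `s₂` and then `t` for `s`. With `u =
        -- tε = s₂ε'` minimal, both exchanges act in front of `ζ`: `w = c'ζ` and `y = cζ`, where `c'
        -- = t₂ε'` and `c = sε` are in the closure. So a single exchange of `c'` for `c` suffices.
        obtain ⟨ε, ε', ζ, u, hu, hu', hdu, hγ, hδ, huz⟩ := H.exists_minExt hz hzδ
        obtain ⟨c, hc, hcy⟩ := mul_of_mul_right hγ hy
        obtain ⟨c', hc', hcw⟩ := mul_of_mul_right hδ hwδ
        have hdc : d c = d u := degree_step H hd hu hc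
        have hdc' : d c' = d u := degree_step H hd₂.symm hu' hc'
        rcases (hzn ▸ H.degree_le huz : d u ≤ n).eq_or_lt with hun | hun
        · obtain ⟨-, rfl⟩ := H.eq_of_degree_eq hcy (hyn.trans (hun.symm.trans hdc.symm))
          exact Or.inl (hEmem hsL htL hs₂ hu hu' hdu hc)
        · refine hRmem (s := c) (t := c') ⟨?_, show d c < n from hdc ▸ hun⟩
            ⟨?_, show d c' < n from hdc' ▸ hun⟩ hw (hdc.trans hdc'.symm) hcw hcy
          · exact step hs ht hs₂.1 hd hu hu' hdu hc
          · exact step ht₂.1 hs₂.1 ht hd₂.symm hu' hu (hdu.trans (sup_comm _ _)) hc'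
    · exact Or.inl (hEmem hsL htL ⟨hx, hxn⟩ hz hz' hdz hy)

lemma finite (H : M.IsUnitalSemigraph d one) (hM : M.FinitelyAligned d) (hF : F.Finite) :
    {x | AlignedClosure M d F x}.Finite := by
  classical
  obtain ⟨N, hN⟩ : ∃ N, ∀ x ∈ F, d x ≤ N :=
    ⟨hF.toFinset.sup d, fun x hx => Finset.le_sup (hF.mem_toFinset.2 hx)⟩
  refine ((Set.finite_Icc 0 N).biUnion fun n _ => finite_degree_eq H hM hF n).subset ?_
  intro x hx
  simp only [Set.mem_iUnion]
  exact ⟨d x, ⟨zero_le, degree_le H hN hx⟩, hx, rfl⟩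

end AlignedClosure

end SemimultiplicativeSet

/-! ### Computations in semigraph algebras -/

namespace SemigraphAlgebra

open SemimultiplicativeSet

variable {k X : Type*} [NonUnitalRing X] [StarRing X] [Module ℂ X]
  [IsScalarTower ℂ X X] [SMulCommClass ℂ X X] [StarModule ℂ X] (S : SemigraphAlgebra k X)

/-- The semimultiplicative set `T₁`. -/
noncomputable abbrev unital : SemimultiplicativeSet (AdjoinUnit S.T) :=
  (nonzeroMul S.T S.T_mul).adjoinUnit

/-- The degree map on `T₁`. -/
abbrev deg : AdjoinUnit S.T → (k →₀ ℕ) := adjoinUnitDegree S.degree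

lemma isUnitalSemigraph : S.unital.IsUnitalSemigraph S.deg .one where
  toIsSemigraph := S.semigraph.isSemigraph
  one_mul _ := rfl
  mul_one x := by cases x <;> rfl

lemma nonzeroMul_eq_some {s t u : S.T} :
    (nonzeroMul S.T S.T_mul).mul s t = some u ↔ (s : X) * t = u := by
  have hu := S.T_ne_zero u u.2
  simp only [nonzeroMul]
  by_cases h : (s : X) * t = 0
  · simp [h, hu.symm]
  · simp [h, Subtype.ext_iff]

lemma val_mul_val {x y z : AdjoinUnit S.T} (h : S.unital.mul x y = some z) :
    x.val * y.val = z.val := by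
  rcases x with _ | s
  · obtain rfl := Option.some_injective _ h
    exact one_mul _
  rcases y with _ | t
  · obtain rfl := Option.some_injective _ h
    exact mul_one _
  obtain ⟨u, hu, rfl⟩ := Option.map_eq_some_iff.1 h
  rw [nonzeroMul_eq_some] at hu
  simp only [AdjoinUnit.val]
  rw [← hu, Unitization.inr_mul]

lemma val_mul_val_eq_zero {x y : AdjoinUnit S.T} (h : S.unital.mul x y = none) :
    x.val * y.val = 0 := by
  rcases x with _ | s
  · cases h
  rcases y with _ | t
  · cases h
  have h : (nonzeroMul S.T S.T_mul).mul s t = none := Option.map_eq_none_iff.1 h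
  have h0 : (s : X) * t = 0 := by
    by_contra h0
    simp [nonzeroMul, h0] at h
  simp only [AdjoinUnit.val]
  rw [← Unitization.inr_mul, h0, Unitization.inr_zero]

lemma val_mul_star_mul_val (x : AdjoinUnit S.T) : x.val * (star x.val * x.val) = x.val := by
  rcases x with _ | s
  · simp [AdjoinUnit.val]
  · simp only [AdjoinUnit.val]
    rw [← Unitization.inr_star, ← Unitization.inr_mul, ← Unitization.inr_mul, ← mul_assoc,
      S.isPartialIsometry s s.2]

/-- A minimal common extension of two elements of equal degree would coincide with both, so for
distinct elements the expansion is an empty sum. -/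
lemma star_val_mul_val_of_ne {x y : AdjoinUnit S.T} (hd : S.deg x = S.deg y) (hne : x ≠ y) :
    star x.val * y.val = 0 := by
  have H := S.isUnitalSemigraph
  rcases x with _ | s
  · exact absurd (H.eq_one (hd.symm.trans H.degree_one)).symm hne
  rcases y with _ | t
  · exact absurd (H.eq_one (hd.trans H.degree_one)) hne
  obtain ⟨q, -, hq⟩ := S.expansion s t
  have hempty : S.unital.minExt S.deg (.of s) (.of t) = ∅ := by
    rw [Set.eq_empty_iff_forall_notMem]
    rintro ⟨a, b⟩ ⟨z, h1, h2, h3⟩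
    obtain ⟨-, rfl⟩ := H.eq_of_degree_eq h1 (by rw [h3, hd, sup_idem])
    obtain ⟨-, h⟩ := H.eq_of_degree_eq h2 (by rw [h3, hd, sup_idem])
    exact hne h
  rw [hempty, finsum_mem_empty] at hq
  simpa [AdjoinUnit.val] using hq

/-- The only minimal common extension of `t` with itself is `(1, 1)`, so the expansion of `t* t` is
a single coefficient from `P`. -/
lemma star_mul_self_mem (t : S.T) : star (t : X) * t ∈ S.P := by
  have H := S.isUnitalSemigraph
  obtain ⟨q, hqP, hq⟩ := S.expansion t t
  have hsingle : S.unital.minExt S.deg (.of t) (.of t) = {(.one, .one)} := by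
    ext ⟨a, b⟩
    simp only [Set.mem_singleton_iff, Prod.mk.injEq]
    constructor
    · rintro ⟨z, h1, h2, h3⟩
      rw [sup_idem] at h3
      exact ⟨(H.eq_of_degree_eq h1 h3).1, (H.eq_of_degree_eq h2 h3).1⟩
    · rintro ⟨rfl, rfl⟩
      exact ⟨.of t, rfl, rfl, by rw [sup_idem]⟩
  rw [hsingle, finsum_mem_singleton] at hq
  have h : star (t : X) * t = q (.one, .one) := by
    apply Unitization.inr_injective (R := ℂ)
    rw [hq]
    simp [AdjoinUnit.val]
  rw [h]
  exact hqP _ (by rw [hsingle]; rfl)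

/-- The image of `P` in the unitization. -/
def projections : Set (Unitization ℂ X) := Set.image (fun p : X => (p : Unitization ℂ X)) S.P

/-- The set `P ∪ {1}` in the unitization. -/
def unitalProjections : Set (Unitization ℂ X) := insert 1 S.projections

variable {S} {p q : Unitization ℂ X}

lemma projections_subset : S.projections ⊆ S.unitalProjections := Set.subset_insert _ _

lemma unitalProjections_mul_mem (hq : q ∈ S.unitalProjections) (hp : p ∈ S.projections) :
    q * p ∈ S.projections := by
  rcases hq with rfl | ⟨q, hq, rfl⟩
  · rwa [one_mul]
  · obtain ⟨p, hp, rfl⟩ := hp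
    exact ⟨q * p, S.P_mul q hq p hp, Unitization.inr_mul _ _ _⟩

lemma unitalProjections_comm (hp : p ∈ S.unitalProjections) (hq : q ∈ S.unitalProjections) :
    p * q = q * p := by
  rcases hq with rfl | ⟨q, hq, rfl⟩
  · simp
  rcases hp with rfl | ⟨p, hp, rfl⟩
  · simp
  · simp only [← Unitization.inr_mul, S.P_comm p hp q hq]

lemma unitalProjections_mul_self (hp : p ∈ S.unitalProjections) : p * p = p := by
  rcases hp with rfl | ⟨p, hp, rfl⟩
  · simp
  · simp only [← Unitization.inr_mul, (S.isProj p hp).1]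

lemma star_unitalProjections (hp : p ∈ S.unitalProjections) : star p = p := by
  rcases hp with rfl | ⟨p, hp, rfl⟩
  · simp
  · simp only [← Unitization.inr_star, (S.isProj p hp).2]

variable (S)

lemma star_val_mul_val_mem (x : AdjoinUnit S.T) : star x.val * x.val ∈ S.unitalProjections := by
  rcases x with _ | s
  · left; simp [AdjoinUnit.val]
  · right
    exact ⟨star (s : X) * s, S.star_mul_self_mem s, by simp [AdjoinUnit.val]⟩

variable {S}

lemma conj_val_mem (hp : p ∈ S.projections) (x : AdjoinUnit S.T) :
    star x.val * p * x.val ∈ S.projections := by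
  rcases x with _ | s
  · simpa [AdjoinUnit.val] using hp
  · obtain ⟨p, hp, rfl⟩ := hp
    obtain ⟨q, hq, h⟩ := S.skip s s.2 p hp
    refine ⟨star (s : X) * s * q, S.P_mul _ (S.star_mul_self_mem s) _ hq, ?_⟩
    rw [mul_assoc, ← h]
    simp [AdjoinUnit.val, mul_assoc]

/-- If `px = xq`, then `x x* p x = x x* x q = xq = px`. This replaces the unspecified `q` of `skip`
by the canonical `x* p x`. -/
lemma mul_val (hp : p ∈ S.projections) (x : AdjoinUnit S.T) :
    p * x.val = x.val * (star x.val * p * x.val) := by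
  rcases x with _ | s
  · simp [AdjoinUnit.val]
  · obtain ⟨p, hp, rfl⟩ := hp
    obtain ⟨q, hq, h⟩ := S.skip s s.2 p hp
    have h1 : (p : Unitization ℂ X) * ((s : X) : Unitization ℂ X) =
        ((s : X) : Unitization ℂ X) * q := by
      rw [← Unitization.inr_mul, h, Unitization.inr_mul]
    have h2 := S.val_mul_star_mul_val (.of s)
    simp only [AdjoinUnit.val] at h2 ⊢
    rw [mul_assoc (star _), h1, ← mul_assoc, ← mul_assoc, mul_assoc _ (star _), h2]

lemma star_val_mul (hp : p ∈ S.projections) (x : AdjoinUnit S.T) :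
    star x.val * p = star x.val * p * x.val * star x.val := by
  have h := congrArg star (S.mul_val hp x)
  have hs := star_unitalProjections (projections_subset (conj_val_mem hp x))
  rw [star_mul, star_mul, hs, star_unitalProjections (projections_subset hp)] at h
  exact h

variable (S)

/-- The minimal common extensions as a finite set. -/
noncomputable def minExtFinset (x y : AdjoinUnit S.T) : Finset (AdjoinUnit S.T × AdjoinUnit S.T) :=
  (S.semigraph.finitelyAligned x y).toFinset

lemma mem_minExtFinset {x y : AdjoinUnit S.T} {a : AdjoinUnit S.T × AdjoinUnit S.T} :
    a ∈ S.minExtFinset x y ↔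
      ∃ z, S.unital.mul x a.1 = some z ∧ S.unital.mul y a.2 = some z ∧
        S.deg z = S.deg x ⊔ S.deg y :=
  (S.semigraph.finitelyAligned x y).mem_toFinset

lemma minExtFinset_one_left (y : AdjoinUnit S.T) : S.minExtFinset .one y = {(y, .one)} := by
  have H := S.isUnitalSemigraph
  have h0 : S.deg .one ⊔ S.deg y = S.deg y := by rw [H.degree_one]; exact sup_of_le_right zero_le
  ext ⟨a, b⟩
  rw [mem_minExtFinset, Finset.mem_singleton, Prod.mk.injEq, h0]
  constructor
  · rintro ⟨z, h1, h2, h3⟩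
    obtain ⟨rfl, rfl⟩ := H.eq_of_degree_eq h2 h3
    exact ⟨Option.some_injective _ h1, rfl⟩
  · rintro ⟨rfl, rfl⟩
    exact ⟨a, H.one_mul a, H.mul_one a, rfl⟩

lemma minExtFinset_one_right (x : AdjoinUnit S.T) : S.minExtFinset x .one = {(.one, x)} := by
  have H := S.isUnitalSemigraph
  have h0 : S.deg x ⊔ S.deg .one = S.deg x := by rw [H.degree_one]; exact sup_of_le_left zero_le
  ext ⟨a, b⟩
  rw [mem_minExtFinset, Finset.mem_singleton, Prod.mk.injEq, h0]
  constructor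
  · rintro ⟨z, h1, h2, h3⟩
    obtain ⟨rfl, rfl⟩ := H.eq_of_degree_eq h1 h3
    exact ⟨rfl, Option.some_injective _ h2⟩
  · rintro ⟨rfl, rfl⟩
    exact ⟨b, H.mul_one b, H.one_mul b, rfl⟩

/-- The expansion of `x* y` with explicit coefficients. -/
lemma star_val_mul_val (x y : AdjoinUnit S.T) : star x.val * y.val =
    ∑ a ∈ S.minExtFinset x y,
      a.1.val * (star (x.val * a.1.val) * (x.val * a.1.val)) * star a.2.val := by
  have H := S.isUnitalSemigraph
  rcases x with _ | s
  · rw [minExtFinset_one_left, Finset.sum_singleton]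
    have := S.val_mul_star_mul_val y
    simp only [AdjoinUnit.val, star_one, one_mul, mul_one] at this ⊢
    exact this.symm
  rcases y with _ | t
  · rw [minExtFinset_one_right, Finset.sum_singleton]
    have := congrArg star (S.val_mul_star_mul_val (.of s))
    rw [star_mul, star_mul, star_star] at this
    simp only [AdjoinUnit.val, one_mul, mul_one] at this ⊢
    exact this.symm
  obtain ⟨q, -, hq⟩ := S.expansion s t
  rw [finsum_mem_eq_finite_toFinset_sum _ (S.semigraph.finitelyAligned _ _)] at hq
  have hq : star (AdjoinUnit.of s).val * (AdjoinUnit.of t).val =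
      ∑ a ∈ S.minExtFinset (.of s) (.of t), a.1.val * (q a : Unitization ℂ X) * star a.2.val := by
    rw [minExtFinset, ← hq]
    simp [AdjoinUnit.val]
  rw [hq]
  refine Finset.sum_congr rfl fun a ha => ?_
  have hz := ha
  rw [mem_minExtFinset] at hz
  obtain ⟨z, hz1, hz2, hdz⟩ := hz
  -- All first components have degree `d(x) ∨ d(y) - d(x)`, and by cancellation they determine the
  -- second ones. So `α*` from the left kills every term but its own.
  have hother : ∀ b ∈ S.minExtFinset (.of s) (.of t), b ≠ a →
      star a.1.val * (b.1.val * (q b : Unitization ℂ X) * star b.2.val) * a.2.val = 0 := by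
    intro b hb hba
    rw [mem_minExtFinset] at hb
    obtain ⟨w, hw1, hw2, hdw⟩ := hb
    have hd : S.deg a.1 = S.deg b.1 := by
      have h1 := H.degree_mul _ _ _ hz1
      have h2 := H.degree_mul _ _ _ hw1
      rw [hdz, ← hdw, h2] at h1
      exact (add_left_cancel h1).symm
    have hne : a.1 ≠ b.1 := by
      intro h
      rw [h, hw1] at hz1
      obtain rfl := Option.some_injective _ hz1
      exact hba (Prod.ext h.symm (H.left_cancel hw2 hz2))
    rw [← mul_assoc, ← mul_assoc, S.star_val_mul_val_of_ne hd hne]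
    simp
  -- With `z = sα = tβ`, the identity `z* z = α*(s* t)β` leaves only the term of `a`. Multiplying
  -- back by `α` and `β*` recovers `α q β*`, as both are partial isometries.
  have key : star ((AdjoinUnit.of s).val * a.1.val) * ((AdjoinUnit.of s).val * a.1.val) =
      star a.1.val * (a.1.val * (q a : Unitization ℂ X) * star a.2.val) * a.2.val := by
    have hst := (S.val_mul_val hz1).trans (S.val_mul_val hz2).symm
    conv_lhs => rhs; rw [hst]
    rw [star_mul, mul_assoc, ← mul_assoc (star (AdjoinUnit.of s).val), hq, ← mul_assoc,
      Finset.mul_sum, Finset.sum_mul]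
    exact Finset.sum_eq_single_of_mem a ha hother
  have h2 : star a.2.val * a.2.val * star a.2.val = star a.2.val := by
    have := congrArg star (S.val_mul_star_mul_val a.2)
    rwa [star_mul, star_mul, star_star] at this
  rw [key]
  calc _ = a.1.val * (star a.1.val * a.1.val) * (q a : Unitization ℂ X) *
        (star a.2.val * a.2.val * star a.2.val) := by rw [S.val_mul_star_mul_val, h2]
    _ = _ := by simp only [mul_assoc]

/-- The projection in the product of two standard words. -/
noncomputable def mulProj (t : AdjoinUnit S.T) (p p' : Unitization ℂ X)
    (a : AdjoinUnit S.T × AdjoinUnit S.T) : Unitization ℂ X :=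
  star a.1.val * p * a.1.val *
    (star (t.val * a.1.val) * (t.val * a.1.val) * (star a.2.val * p' * a.2.val))

/-- After `t* s'` is expanded, `pα = α(α* p α)` and its adjoint form move the outer projections to
the centre. -/
lemma standard_mul {p p' : Unitization ℂ X} (hp : p ∈ S.projections) (hp' : p' ∈ S.projections)
    (s t s' t' : AdjoinUnit S.T) :
    s.val * p * star t.val * (s'.val * p' * star t'.val) = ∑ a ∈ S.minExtFinset t s',
      s.val * a.1.val * S.mulProj t p p' a * star (t'.val * a.2.val) := by
  have h : s.val * p * star t.val * (s'.val * p' * star t'.val) =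
      s.val * p * (star t.val * s'.val) * (p' * star t'.val) := by simp only [mul_assoc]
  rw [h, star_val_mul_val, Finset.mul_sum, Finset.sum_mul]
  refine Finset.sum_congr rfl fun a _ => ?_
  calc _ = s.val * (p * a.1.val) * (star (t.val * a.1.val) * (t.val * a.1.val)) *
        (star a.2.val * p') * star t'.val := by simp only [mul_assoc]
    _ = _ := by
      rw [mul_val hp, star_val_mul hp', mulProj, star_mul t'.val]
      simp only [mul_assoc]

lemma mulProj_mem {p p' : Unitization ℂ X} (hp : p ∈ S.projections) (hq : p' ∈ S.projections)
    {t z : AdjoinUnit S.T} {a : AdjoinUnit S.T × AdjoinUnit S.T}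
    (h : S.unital.mul t a.1 = some z) : S.mulProj t p p' a ∈ S.projections := by
  rw [mulProj, S.val_mul_val h]
  exact unitalProjections_mul_mem (projections_subset (conj_val_mem hp _))
    (unitalProjections_mul_mem (S.star_val_mul_val_mem z) (conj_val_mem hq _))

/-- The standard word `s p t*`. -/
noncomputable def word (s : AdjoinUnit S.T) (p : X) (t : AdjoinUnit S.T) : X :=
  (s.val * (p : Unitization ℂ X) * star t.val).snd

lemma coe_word (s : AdjoinUnit S.T) (p : X) (t : AdjoinUnit S.T) :
    (S.word s p t : Unitization ℂ X) = s.val * (p : Unitization ℂ X) * star t.val := by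
  ext <;> simp [word]

lemma star_word (s t : AdjoinUnit S.T) {p : X} (hp : p ∈ S.P) :
    star (S.word s p t) = S.word t p s := by
  apply Unitization.inr_injective (R := ℂ)
  rw [Unitization.inr_star, coe_word, coe_word, star_mul, star_mul, star_star, ← mul_assoc,
    ← Unitization.inr_star, (S.isProj p hp).2]

/-- Terms for which `sα` or `t'β` is undefined drop out, since undefined products are zero in `X`.
-/
lemma word_mul {p p' : X} (hp : p ∈ S.P) (hp' : p' ∈ S.P) (s t s' t' : AdjoinUnit S.T) :
    S.word s p t * S.word s' p' t' ∈ Submodule.span ℂ {x | ∃ a z u u' r,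
      S.unital.mul t a.1 = some z ∧ S.unital.mul s' a.2 = some z ∧
      S.deg z = S.deg t ⊔ S.deg s' ∧ S.unital.mul s a.1 = some u ∧
      S.unital.mul t' a.2 = some u' ∧ r ∈ S.P ∧
      (r : Unitization ℂ X) = S.mulProj t p p' a ∧ x = S.word u r u'} := by
  have hp : (p : Unitization ℂ X) ∈ S.projections := ⟨p, hp, rfl⟩
  have hp' : (p' : Unitization ℂ X) ∈ S.projections := ⟨p', hp', rfl⟩
  have h : S.word s p t * S.word s' p' t' = ∑ a ∈ S.minExtFinset t s',
      (s.val * a.1.val * S.mulProj t p p' a * star (t'.val * a.2.val)).snd := by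
    have h := congrArg (Unitization.sndHom ℂ ℂ X) (S.standard_mul hp hp' s t s' t')
    rw [← coe_word, ← coe_word, ← Unitization.inr_mul, map_sum] at h
    exact h
  rw [h]
  refine Submodule.sum_mem _ fun a ha => ?_
  obtain ⟨z, h1, h2, h3⟩ := S.mem_minExtFinset.1 ha
  cases hu : S.unital.mul s a.1 with
  | none => rw [S.val_mul_val_eq_zero hu]; simp
  | some u =>
  cases hu' : S.unital.mul t' a.2 with
  | none => rw [S.val_mul_val_eq_zero hu']; simp
  | some u' =>
  obtain ⟨r, hr, hr'⟩ := S.mulProj_mem hp hp' h1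
  refine Submodule.subset_span ⟨a, z, u, u', r, h1, h2, h3, hu, hu', hr, hr', ?_⟩
  rw [word, S.val_mul_val hu, S.val_mul_val hu', ← hr']

end SemigraphAlgebra

/-! ### Standard projections -/

lemma OrthogonalSum.star_eq {X : Type*} [NonUnitalRing X] [StarRing X] {Z : Set X} {e : X}
    (hZ : ∀ z ∈ Z, star z = z) (he : OrthogonalSum Z e) : star e = e := by
  induction he with
  | zero => exact star_zero _
  | add _ hf _ _ ih => rw [star_add, ih, hZ _ hf]

lemma Submodule.mul_mem_of_span {X : Type*} [NonUnitalRing X] [Module ℂ X]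
    [IsScalarTower ℂ X X] [SMulCommClass ℂ X X] {A B : Set X} {N : Submodule ℂ X}
    (h : ∀ x ∈ A, ∀ y ∈ B, x * y ∈ N) {x y : X} (hx : x ∈ Submodule.span ℂ A)
    (hy : y ∈ Submodule.span ℂ B) : x * y ∈ N := by
  induction hx, hy using Submodule.span_induction₂ with
  | mem_mem x y hx hy => exact h x hx y hy
  | zero_left y _ => simp
  | zero_right x _ => simp
  | add_left x y z _ _ _ h1 h2 => rw [add_mul]; exact N.add_mem h1 h2
  | add_right x y z _ _ _ h1 h2 => rw [mul_add]; exact N.add_mem h1 h2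
  | smul_left r x y _ _ h => rw [smul_mul_assoc]; exact N.smul_mem r h
  | smul_right r x y _ _ h => rw [mul_smul_comm]; exact N.smul_mem r h

lemma AdjoinUnit.val_one {X : Type*} [NonUnitalRing X] {T : Set X} :
    (AdjoinUnit.one : AdjoinUnit T).val = 1 := rfl

namespace SemigraphAlgebra

open SemimultiplicativeSet

variable {k X : Type*} [NonUnitalRing X] [StarRing X] [Module ℂ X]
  [IsScalarTower ℂ X X] [SMulCommClass ℂ X X] [StarModule ℂ X] (S : SemigraphAlgebra k X)

lemma word_mul_word_same {s t t' : AdjoinUnit S.T} {p p' : X}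
    (h : star t.val * t.val * (p' : Unitization ℂ X) = p') :
    S.word s p t * S.word t p' t' = S.word s (p * p') t' := by
  apply Unitization.inr_injective (R := ℂ)
  rw [Unitization.inr_mul, coe_word, coe_word, coe_word, Unitization.inr_mul]
  calc _ = s.val * (p : Unitization ℂ X) *
        (star t.val * t.val * (p' : Unitization ℂ X)) * star t'.val := by simp only [mul_assoc]
    _ = _ := by rw [h]; simp only [mul_assoc]

lemma word_mul_word_of_ne {s t s' t' : AdjoinUnit S.T} {p p' : X} (hd : S.deg t = S.deg s')
    (hne : t ≠ s') : S.word s p t * S.word s' p' t' = 0 := by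
  apply Unitization.inr_injective (R := ℂ)
  rw [Unitization.inr_mul, coe_word, coe_word, Unitization.inr_zero]
  calc _ = s.val * (p : Unitization ℂ X) *
        (star t.val * s'.val) * ((p' : Unitization ℂ X) * star t'.val) := by simp only [mul_assoc]
    _ = _ := by rw [S.star_val_mul_val_of_ne hd hne]; simp

/-- The word `s p t*` does not change when `p` is cut down by the sources `s* s` and `t* t`. The cut
projection satisfies the support condition under which words multiply like matrix units. -/
lemma exists_source_cut (s t : AdjoinUnit S.T) {p : X} (hp : p ∈ S.P) : ∃ r ∈ S.P,
    (r : Unitization ℂ X) = star s.val * s.val * (star t.val * t.val * p) := by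
  obtain ⟨r, hr, hr'⟩ := unitalProjections_mul_mem (S.star_val_mul_val_mem s)
    (unitalProjections_mul_mem (S.star_val_mul_val_mem t) ⟨p, hp, rfl⟩)
  exact ⟨r, hr, hr'⟩

lemma word_eq_word_of_source_cut {s t : AdjoinUnit S.T} {p r : X} (hp : p ∈ S.P)
    (h : (r : Unitization ℂ X) = star s.val * s.val * (star t.val * t.val * p)) :
    S.word s p t = S.word s r t := by
  have h2 : star t.val * t.val * star t.val = star t.val := by
    have := congrArg star (S.val_mul_star_mul_val t)
    rwa [star_mul, star_mul, star_star] at this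
  apply Unitization.inr_injective (R := ℂ)
  rw [coe_word, coe_word, h,
    unitalProjections_comm (S.star_val_mul_val_mem t) (projections_subset ⟨p, hp, rfl⟩)]
  calc _ = s.val * (star s.val * s.val) * (p : Unitization ℂ X) *
        (star t.val * t.val * star t.val) := by rw [h2, S.val_mul_star_mul_val]
    _ = _ := by simp only [mul_assoc]

lemma source_mul_of_source_cut {s t : AdjoinUnit S.T} {p r : X}
    (h : (r : Unitization ℂ X) = star s.val * s.val * (star t.val * t.val * p)) :
    star s.val * s.val * (r : Unitization ℂ X) = r ∧
      star t.val * t.val * (r : Unitization ℂ X) = r := by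
  have hs := S.star_val_mul_val_mem s
  have ht := S.star_val_mul_val_mem t
  rw [h]
  constructor
  · rw [← mul_assoc, unitalProjections_mul_self hs]
  · rw [← mul_assoc, unitalProjections_comm ht hs, mul_assoc, ← mul_assoc (star t.val * t.val),
      unitalProjections_mul_self ht]

/-- The range projections of half-standard words. -/
def basicProjections : Set X := {e | ∃ s, ∃ p ∈ S.P, e = S.word s p s}

lemma basicProjections_eq :
    S.basicProjections = {e | ∃ x ∈ S.halfStandardWords, e = x * star x} := by
  have key : ∀ (s : AdjoinUnit S.T) (p x : X), p ∈ S.P →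
      (x : Unitization ℂ X) = s.val * (p : Unitization ℂ X) → x * star x = S.word s p s := by
    intro s p x hp hx
    apply Unitization.inr_injective (R := ℂ)
    have hp1 : (p : Unitization ℂ X) ∈ S.unitalProjections := projections_subset ⟨p, hp, rfl⟩
    rw [Unitization.inr_mul, Unitization.inr_star, hx, coe_word, star_mul,
      star_unitalProjections hp1, mul_assoc, ← mul_assoc (p : Unitization ℂ X),
      unitalProjections_mul_self hp1, mul_assoc]
  ext e
  constructor
  · rintro ⟨s, p, hp, rfl⟩
    have hx : ((s.val * (p : Unitization ℂ X)).snd : Unitization ℂ X) =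
        s.val * (p : Unitization ℂ X) := by ext <;> simp
    exact ⟨_, ⟨s, p, hp, hx⟩, (key s p _ hp hx).symm⟩
  · rintro ⟨x, ⟨s, p, hp, hx⟩, rfl⟩
    exact ⟨s, p, hp, key s p x hp hx⟩

lemma standardProjections_eq : S.standardProjections = {a | Refinement S.basicProjections a} := by
  rw [standardProjections, refinedProjections_eq, basicProjections_eq]

lemma basicProjections_mul_self {e : X} (he : e ∈ S.basicProjections) : e * e = e := by
  obtain ⟨s, p, hp, rfl⟩ := he
  obtain ⟨r, hr, h⟩ := S.exists_source_cut s s hp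
  rw [S.word_eq_word_of_source_cut hp h, S.word_mul_word_same (S.source_mul_of_source_cut h).1,
    (S.isProj r hr).1]

lemma star_basicProjections {e : X} (he : e ∈ S.basicProjections) : star e = e := by
  obtain ⟨s, p, hp, rfl⟩ := he
  exact S.star_word s s hp

/-- The product is a sum of terms `z r z*` over the minimal common extensions `z` of `s` and `t`.
These all have degree `d(s) ∨ d(t)` and are distinct, hence the terms are orthogonal. -/
lemma orthogonalSum_basicProjections_mul {e f : X} (he : e ∈ S.basicProjections)
    (hf : f ∈ S.basicProjections) : OrthogonalSum S.basicProjections (e * f) := by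
  have H := S.isUnitalSemigraph
  obtain ⟨s, p, hp, rfl⟩ := he
  obtain ⟨t, q, hq, rfl⟩ := hf
  have hp : (p : Unitization ℂ X) ∈ S.projections := ⟨p, hp, rfl⟩
  have hq : (q : Unitization ℂ X) ∈ S.projections := ⟨q, hq, rfl⟩
  have h : S.word s p s * S.word t q t = ∑ a ∈ S.minExtFinset s t,
      (s.val * a.1.val * S.mulProj s p q a * star (t.val * a.2.val)).snd := by
    have h := congrArg (Unitization.sndHom ℂ ℂ X) (S.standard_mul hp hq s s t t)
    rw [← coe_word, ← coe_word, ← Unitization.inr_mul, map_sum] at h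
    exact h
  have hterm : ∀ a ∈ S.minExtFinset s t, ∃ z r, r ∈ S.P ∧ S.unital.mul s a.1 = some z ∧
      S.unital.mul t a.2 = some z ∧ S.deg z = S.deg s ⊔ S.deg t ∧
      (s.val * a.1.val * S.mulProj s p q a * star (t.val * a.2.val)).snd = S.word z r z := by
    intro a ha
    obtain ⟨z, h1, h2, h3⟩ := S.mem_minExtFinset.1 ha
    obtain ⟨r, hr, hr'⟩ := S.mulProj_mem hp hq h1
    exact ⟨z, r, hr, h1, h2, h3, by rw [S.val_mul_val h1, S.val_mul_val h2, word, ← hr']⟩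
  rw [h]
  refine OrthogonalSum.sum (fun _ => S.basicProjections_mul_self) _ _ (fun a ha => ?_) ?_
  · obtain ⟨z, r, hr, -, -, -, hw⟩ := hterm a ha
    rw [hw]
    exact .of_mem ⟨z, r, hr, rfl⟩
  · intro a ha b hb hab
    obtain ⟨z, r, -, h1, h2, h3, hw⟩ := hterm a ha
    obtain ⟨z', r', -, h1', h2', h3', hw'⟩ := hterm b hb
    rw [hw, hw']
    refine S.word_mul_word_of_ne (h3.trans h3'.symm) ?_
    rintro rfl
    exact hab (Prod.ext (H.left_cancel h1 h1') (H.left_cancel h2 h2'))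

lemma isProjectionFamily_basicProjections : IsProjectionFamily S.basicProjections where
  idem _ := S.basicProjections_mul_self
  mul _ hz _ hw := S.orthogonalSum_basicProjections_mul hz hw
  -- The product `wz` is a sum of self-adjoint elements, so `zw = (wz)* = wz`.
  comm z hz w hw := by
    have h := (S.orthogonalSum_basicProjections_mul hw hz).star_eq fun _ => S.star_basicProjections
    rwa [star_mul, S.star_basicProjections hz, S.star_basicProjections hw] at h

lemma standardProjections_mul_self : ∀ e ∈ S.standardProjections, e * e = e := by
  rw [standardProjections_eq]
  exact fun _ => Refinement.mul_self S.isProjectionFamily_basicProjections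

lemma orthogonalSum_standardProjections_sub_mul (e f : X)
    (he : OrthogonalSum S.standardProjections e) (hf : OrthogonalSum S.standardProjections f) :
    OrthogonalSum S.standardProjections (e - e * f) := by
  rw [standardProjections_eq] at *
  exact Refinement.orthogonalSum_sub_mul S.isProjectionFamily_basicProjections he hf

/-! ### Blocks of standard words -/

/-- The span of the words `s p t*` with `s, t ∈ F` of degree `n` and `p ≤ s* s, t* t`. -/
def block (F : Set (AdjoinUnit S.T)) (n : k →₀ ℕ) (p : X) : Submodule ℂ X :=
  Submodule.span ℂ {x | ∃ s ∈ F, ∃ t ∈ F, S.deg s = n ∧ S.deg t = n ∧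
    star s.val * s.val * (p : Unitization ℂ X) = p ∧
    star t.val * t.val * (p : Unitization ℂ X) = p ∧ x = S.word s p t}

/-- In `(s p t*)(t' p v*)` the middle factor `t* t'` vanishes unless `t = t'`, in which case it is
absorbed by `p`. -/
lemma isMatricial_block {F : Set (AdjoinUnit S.T)} (hF : F.Finite) (n : k →₀ ℕ) {p : X}
    (hp : p ∈ S.P) : IsMatricial (OrthogonalSum S.standardProjections) (S.block F n p) := by
  let N := {s : AdjoinUnit S.T // s ∈ F ∧ S.deg s = n ∧
    star s.val * s.val * (p : Unitization ℂ X) = p}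
  have hN : Finite N := (hF.subset fun s hs => hs.1 : {s : AdjoinUnit S.T | s ∈ F ∧ S.deg s = n ∧
    star s.val * s.val * (p : Unitization ℂ X) = p}.Finite)
  let E : MatrixUnits X Unit fun _ => N :=
    { e := fun _ s t => S.word s.1 p t.1
      mul_same := fun _ s t u => by
        rw [S.word_mul_word_same t.2.2.2, (S.isProj p hp).1]
      mul_of_ne := fun _ s t u v h =>
        S.word_mul_word_of_ne (t.2.2.1.trans u.2.2.1.symm) fun h' => h (Subtype.ext h')
      mul_of_block_ne := fun i j h => absurd rfl h
      star_eq := fun _ s t => S.star_word s.1 t.1 hp }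
  have := IsMatricial.of_matrixUnits (D := OrthogonalSum S.standardProjections) E (fun _ s => by
    rw [standardProjections_eq]
    exact .of_mem (.basic ⟨s.1, p, hp, rfl⟩))
  suffices hE : {x | ∃ s ∈ F, ∃ t ∈ F, S.deg s = n ∧ S.deg t = n ∧
      star s.val * s.val * (p : Unitization ℂ X) = p ∧
      star t.val * t.val * (p : Unitization ℂ X) = p ∧ x = S.word s p t} = E.units by
    rwa [block, hE]
  ext x
  constructor
  · rintro ⟨s, hs, t, ht, hds, hdt, hps, hpt, rfl⟩
    exact ⟨(), ⟨s, hs, hds, hps⟩, ⟨t, ht, hdt, hpt⟩, rfl⟩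
  · rintro ⟨_, s, t, rfl⟩
    exact ⟨s.1, s.2.1, t.1, t.2.1, s.2.2.1, t.2.2.1, s.2.2.2, t.2.2.2, rfl⟩

/-- The index set of blocks: a degree and a projection. -/
@[ext]
structure BlockIndex where
  level : k →₀ ℕ
  proj : X
  mem : proj ∈ S.P

/-- Products go downwards in this order: the level may rise, and if it stays the same the projection
decreases. -/
instance : PartialOrder S.BlockIndex where
  le i j := j.level ≤ i.level ∧ (i.level = j.level → i.proj * j.proj = i.proj)
  le_refl i := ⟨le_rfl, fun _ => (S.isProj _ i.mem).1⟩
  le_trans i j l h1 h2 := by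
    refine ⟨h2.1.trans h1.1, fun h => ?_⟩
    have hij : i.level = j.level := le_antisymm (h.le.trans h2.1) h1.1
    rw [← h1.2 hij, mul_assoc, h2.2 (hij.symm.trans h)]
  le_antisymm i j h1 h2 := by
    have h := le_antisymm h2.1 h1.1
    refine BlockIndex.ext h ?_
    rw [← h1.2 h, S.P_comm _ i.mem _ j.mem, h2.2 h.symm]

/-- A finite set of elements of `T₁` and finite sets of projections, indexed by the total degree,
such that the standard words built from them span a `*`-algebra. -/
structure Frame where
  F : Set (AdjoinUnit S.T)
  Q : ℕ → Set X
  finite_F : F.Finite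
  F_step : ∀ {s t x y z γ γ'}, s ∈ F → t ∈ F → x ∈ F → S.deg s = S.deg t →
    S.unital.mul t γ = some z → S.unital.mul x γ' = some z → S.deg z = S.deg t ⊔ S.deg x →
    S.unital.mul s γ = some y → y ∈ F
  finite_Q : ∀ r, (Q r).Finite
  Q_subset : ∀ r, Q r ⊆ S.P
  Q_mono : Monotone Q
  Q_mul : ∀ r, ∀ p ∈ Q r, ∀ q ∈ Q r, p * q ∈ Q r
  Q_source : ∀ r, ∀ z ∈ F, ∀ p ∈ Q r, ∀ q : X,
    (q : Unitization ℂ X) = star z.val * z.val * p → q ∈ Q r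
  Q_conj : ∀ r, ∀ t ∈ F, ∀ z ∈ F, ∀ α, S.unital.mul t α = some z → ∀ p ∈ Q r, ∀ q : X,
    (q : Unitization ℂ X) = star α.val * p * α.val → q ∈ Q (r + 1)

/-! ### Finite frames and the algebras they span -/

namespace Frame

variable {S} (Φ : S.Frame)

/-- The indices of the blocks of a frame. -/
def indices : Set S.BlockIndex := {i | ∃ x ∈ Φ.F, i.level = S.deg x ∧ i.proj ∈ Φ.Q i.level.degree}

lemma finite_indices : Φ.indices.Finite := by
  have hfin : ((S.deg '' Φ.F) ×ˢ ⋃ x ∈ Φ.F, Φ.Q (S.deg x).degree).Finite :=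
    (Φ.finite_F.image _).prod (Φ.finite_F.biUnion fun x _ => Φ.finite_Q _)
  refine Set.Finite.of_finite_image (f := fun i => (i.level, i.proj)) (hfin.subset ?_) ?_
  · rintro _ ⟨i, ⟨x, hx, hix, hiQ⟩, rfl⟩
    refine ⟨⟨x, hx, hix.symm⟩, ?_⟩
    simp only [Set.mem_iUnion]
    exact ⟨x, hx, hix ▸ hiQ⟩
  · intro i _ j _ h
    exact BlockIndex.ext (Prod.ext_iff.1 h).1 (Prod.ext_iff.1 h).2

/-- For `α = 1` nothing changes. Otherwise the total degree of `z` exceeds that of `t`, which leaves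
room for the passage from `Q r` to `Q (r + 1)`; this is why the sets `Q` are graded and need not be
closed under conjugation. -/
lemma conj_mem {t z α : AdjoinUnit S.T} (ht : t ∈ Φ.F) (hz : z ∈ Φ.F)
    (h : S.unital.mul t α = some z) {p q : X} (hp : p ∈ Φ.Q (S.deg t).degree)
    (hq : (q : Unitization ℂ X) = star α.val * p * α.val) : q ∈ Φ.Q (S.deg z).degree := by
  have H := S.isUnitalSemigraph
  by_cases hα : S.deg α = 0
  · obtain rfl := H.eq_one hα
    rw [H.mul_one] at h
    obtain rfl := Option.some_injective _ h
    have : q = p := Unitization.inr_injective (R := ℂ) (by simpa [AdjoinUnit.val] using hq)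
    rwa [this]
  · refine Φ.Q_mono ?_ (Φ.Q_conj _ t ht z hz α h p hp q hq)
    rw [H.degree_mul _ _ _ h, map_add]
    have : (S.deg α).degree ≠ 0 := fun h0 => hα ((Finsupp.degree_eq_zero_iff _).1 h0)
    omega

/-- The projections in the product of two words of a frame again belong to the frame. -/
lemma mulProj_mem {s t z : AdjoinUnit S.T} (hs : s ∈ Φ.F) (ht : t ∈ Φ.F) (hz : z ∈ Φ.F)
    {a : AdjoinUnit S.T × AdjoinUnit S.T} (h1 : S.unital.mul t a.1 = some z)
    (h2 : S.unital.mul s a.2 = some z) {p q r : X} (hp : p ∈ Φ.Q (S.deg t).degree)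
    (hq : q ∈ Φ.Q (S.deg s).degree) (hr : (r : Unitization ℂ X) = S.mulProj t p q a) :
    r ∈ Φ.Q (S.deg z).degree := by
  obtain ⟨p₁, -, h₁⟩ := conj_val_mem (S := S) ⟨p, Φ.Q_subset _ hp, rfl⟩ a.1
  obtain ⟨q₁, hq₁, h₂⟩ := conj_val_mem (S := S) ⟨q, Φ.Q_subset _ hq, rfl⟩ a.2
  obtain ⟨q₂, -, h₃⟩ := unitalProjections_mul_mem (S.star_val_mul_val_mem z) ⟨q₁, hq₁, rfl⟩
  have hp₁ := Φ.conj_mem ht hz h1 hp h₁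
  have hq₁ := Φ.conj_mem hs hz h2 hq h₂
  have hq₂ := Φ.Q_source _ z hz _ hq₁ _ h₃
  have : r = p₁ * q₂ := by
    apply Unitization.inr_injective (R := ℂ)
    rw [hr, mulProj, S.val_mul_val h1, Unitization.inr_mul]
    simp only at h₁ h₂ h₃
    rw [h₁, h₃, h₂]
  rw [this]
  exact Φ.Q_mul _ _ hp₁ _ hq₂

/-- A word of a frame lies in one of its blocks. -/
lemma word_mem_block {u u' : AdjoinUnit S.T} (hu : u ∈ Φ.F) (hu' : u' ∈ Φ.F)
    (hd : S.deg u = S.deg u') {r : X} (hr : r ∈ Φ.Q (S.deg u).degree) :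
    ∃ i ∈ Φ.indices, i.level = S.deg u ∧ (∀ q, r * q = r → i.proj * q = i.proj) ∧
      S.word u r u' ∈ S.block Φ.F i.level i.proj := by
  have hrP := Φ.Q_subset _ hr
  obtain ⟨r₁, hr₁, h₁⟩ := unitalProjections_mul_mem (S.star_val_mul_val_mem u') ⟨r, hrP, rfl⟩
  obtain ⟨r₂, hr₂, h₂⟩ := unitalProjections_mul_mem (S.star_val_mul_val_mem u) ⟨r₁, hr₁, rfl⟩
  have hQ := Φ.Q_source _ u hu _ (Φ.Q_source _ u' hu' _ hr _ h₁) _ h₂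
  have hcut : (r₂ : Unitization ℂ X) = star u.val * u.val * (star u'.val * u'.val * r) := by
    simp only at h₁ h₂
    rw [h₂, h₁]
  have hsrc := S.source_mul_of_source_cut hcut
  -- The projection of the block is `r` cut down by both sources; hence every `q` above `r` is also
  -- above it.
  refine ⟨⟨S.deg u, r₂, hr₂⟩, ⟨u, hu, rfl, hQ⟩, rfl, fun q hq => ?_, ?_⟩
  · apply Unitization.inr_injective (R := ℂ)
    rw [Unitization.inr_mul, hcut]
    conv_rhs => rw [← hq, Unitization.inr_mul]
    simp only [mul_assoc]
  · rw [S.word_eq_word_of_source_cut hrP hcut]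
    exact Submodule.subset_span ⟨u, hu, u', hu', rfl, hd.symm, hsrc.1, hsrc.2, rfl⟩

/-- Each word in the product has the degree of a common extension of `t` and `s'`, hence at least
both levels. Closure of the frame keeps its outer factors in `F` and its projection in `Q`. -/
lemma block_mul_block {i j : S.BlockIndex} (hi : i ∈ Φ.indices) (hj : j ∈ Φ.indices) {x y : X}
    (hx : x ∈ S.block Φ.F i.level i.proj) (hy : y ∈ S.block Φ.F j.level j.proj) :
    x * y ∈ ⨆ (l : S.BlockIndex) (_ : l ∈ Φ.indices ∧ l ≤ i ∧ l ≤ j),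
      S.block Φ.F l.level l.proj := by
  have H := S.isUnitalSemigraph
  obtain ⟨-, -, -, hiQ⟩ := hi
  obtain ⟨-, -, -, hjQ⟩ := hj
  refine Submodule.mul_mem_of_span ?_ hx hy
  rintro x ⟨s, hs, t, ht, hds, hdt, -, -, rfl⟩ y ⟨s', hs', t', ht', hds', hdt', -, -, rfl⟩
  refine (Submodule.span_le.2 ?_) (S.word_mul i.mem j.mem s t s' t')
  rintro x ⟨a, z, u, u', r, h1, h2, h3, hu, hu', hr, hra, rfl⟩
  have huF := Φ.F_step hs ht hs' (hds.trans hdt.symm) h1 h2 h3 hu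
  have hu'F := Φ.F_step ht' hs' ht (hdt'.trans hds'.symm) h2 h1 (h3.trans (sup_comm _ _)) hu'
  -- Exchanging `t` for itself puts the common extension `z` into `F`.
  have hzF := Φ.F_step ht ht hs' rfl h1 h2 h3 h1
  have hdu : S.deg u = S.deg z :=
    AlignedClosure.degree_step H (hds.trans hdt.symm) h1 hu
  have hdu' : S.deg u' = S.deg z :=
    AlignedClosure.degree_step H (hdt'.trans hds'.symm) h2 hu'
  have hrQ : r ∈ Φ.Q (S.deg u).degree := by
    rw [hdu]
    exact Φ.mulProj_mem hs' ht hzF h1 h2 (by rwa [hdt]) (by rwa [hds']) hra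
  obtain ⟨l, hl, hlu, hlr, hmem⟩ := Φ.word_mem_block huF hu'F (hdu.trans hdu'.symm) hrQ
  have hip : (i.proj : Unitization ℂ X) ∈ S.projections := ⟨_, i.mem, rfl⟩
  have hjp : (j.proj : Unitization ℂ X) ∈ S.projections := ⟨_, j.mem, rfl⟩
  have hlz : l.level = S.deg z := hlu.trans hdu
  refine Submodule.mem_iSup_of_mem l (Submodule.mem_iSup_of_mem ⟨hl, ⟨?_, fun h => ?_⟩,
    ⟨?_, fun h => ?_⟩⟩ hmem)
  · rw [hlz, ← hdt]; exact H.degree_le h1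
  · refine hlr _ ?_
    -- Equal levels force `α = 1`, so `p` itself is a factor of `r`.
    have ha := (H.eq_of_degree_eq h1 (hlz.symm.trans (h.trans hdt.symm))).1
    rw [S.P_comm _ hr _ i.mem]
    apply Unitization.inr_injective (R := ℂ)
    rw [Unitization.inr_mul, hra, mulProj, ha]
    simp only [AdjoinUnit.val_one, star_one, one_mul, mul_one]
    rw [← mul_assoc, unitalProjections_mul_self (projections_subset hip)]
  · rw [hlz, ← hds']; exact H.degree_le h2
  · refine hlr _ ?_
    have ha := (H.eq_of_degree_eq h2 (hlz.symm.trans (h.trans hds'.symm))).1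
    apply Unitization.inr_injective (R := ℂ)
    rw [Unitization.inr_mul, hra, mulProj, ha]
    simp only [AdjoinUnit.val_one, star_one, one_mul, mul_one, mul_assoc,
      unitalProjections_mul_self (projections_subset hjp)]

/-- The span of all words of a frame. -/
noncomputable def algebra : Submodule ℂ X :=
  ⨆ i ∈ Φ.finite_indices.toFinset, S.block Φ.F i.level i.proj

lemma isMatricial_algebra : IsMatricial (OrthogonalSum S.standardProjections) Φ.algebra := by
  refine IsMatricial.iSup S.standardProjections_mul_self
    S.orthogonalSum_standardProjections_sub_mul _
    (fun i : S.BlockIndex => S.block Φ.F i.level i.proj)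
    (fun i _ => S.isMatricial_block Φ.finite_F _ i.mem) fun i hi j hj x hx y hy => ?_
  simp only [Set.Finite.mem_toFinset] at hi hj ⊢
  exact Φ.block_mul_block hi hj hx hy

lemma word_mem_algebra {s t : AdjoinUnit S.T} (hs : s ∈ Φ.F) (ht : t ∈ Φ.F)
    (hd : S.deg s = S.deg t) {p : X} (hp : p ∈ Φ.Q 0) : S.word s p t ∈ Φ.algebra := by
  obtain ⟨i, hi, -, -, hmem⟩ := Φ.word_mem_block hs ht hd (Φ.Q_mono (Nat.zero_le _) hp)
  exact Submodule.mem_iSup_of_mem i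
    (Submodule.mem_iSup_of_mem (Φ.finite_indices.mem_toFinset.2 hi) hmem)

lemma algebra_le : Φ.algebra ≤
    Submodule.span ℂ {x | ∃ s, ∃ p ∈ S.P, ∃ t, S.deg s = S.deg t ∧ x = S.word s p t} := by
  refine iSup₂_le fun i _ => Submodule.span_mono ?_
  rintro x ⟨s, -, t, -, hs, ht, -, -, rfl⟩
  exact ⟨s, i.proj, i.mem, t, hs.trans ht.symm, rfl⟩

end Frame

end SemigraphAlgebra

/-! ### The core -/

namespace SemigraphAlgebra

open SemimultiplicativeSet

variable {k X : Type*} [NonUnitalRing X] [StarRing X] [Module ℂ X]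
  [IsScalarTower ℂ X X] [SMulCommClass ℂ X X] [StarModule ℂ X] (S : SemigraphAlgebra k X)

/-- For commuting idempotents, adjoining one generator `a` to a closed set `C` only adds `a` and the
products `aC`. -/
lemma exists_finite_mul_closed {A : Set X} (hA : A.Finite) (hAP : A ⊆ S.P) :
    ∃ C : Set X, C.Finite ∧ A ⊆ C ∧ C ⊆ S.P ∧ ∀ p ∈ C, ∀ q ∈ C, p * q ∈ C := by
  induction A, hA using Set.Finite.induction_on with
  | empty => exact ⟨∅, Set.finite_empty, subset_rfl, Set.empty_subset _, by simp⟩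
  | @insert a A _ _ ih =>
    obtain ⟨C, hC, hAC, hCP, hmul⟩ := ih ((Set.subset_insert a A).trans hAP)
    have ha : a ∈ S.P := hAP (Set.mem_insert a A)
    have ha2 := (S.isProj a ha).1
    refine ⟨insert a (C ∪ (a * ·) '' C), (hC.union (hC.image _)).insert a,
      Set.insert_subset_insert (hAC.trans Set.subset_union_left), ?_, ?_⟩
    · rintro x (rfl | hx | ⟨c, hc, rfl⟩)
      exacts [ha, hCP hx, S.P_mul _ ha _ (hCP hc)]
    · rintro x (rfl | hx | ⟨c, hc, rfl⟩) y (rfl | hy | ⟨e, he, rfl⟩)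
      · left; exact ha2
      · right; right; exact ⟨y, hy, rfl⟩
      · right; right; exact ⟨e, he, by simp only [← mul_assoc, ha2]⟩
      · right; right; exact ⟨x, hx, S.P_comm _ ha _ (hCP hx)⟩
      · right; left; exact hmul x hx y hy
      · right; right
        exact ⟨x * e, hmul x hx e he, by
          simp only [← mul_assoc, S.P_comm _ ha _ (hCP hx)]⟩
      · right; right
        exact ⟨c, hc, by
          simp only
          rw [mul_assoc, S.P_comm _ (hCP hc) _ ha, ← mul_assoc, ha2]⟩
      · right; right; exact ⟨c * y, hmul c hc y hy, (mul_assoc _ _ _).symm⟩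
      · right; right
        refine ⟨c * e, hmul c hc e he, ?_⟩
        simp only
        rw [mul_assoc a c, ← mul_assoc c a e, S.P_comm _ (hCP hc) _ ha, mul_assoc a c e,
          ← mul_assoc a a, ha2]

lemma exists_frame {F₀ : Set (AdjoinUnit S.T)} {Q₀ : Set X} (hF₀ : F₀.Finite) (hQ₀ : Q₀.Finite)
    (hQP : Q₀ ⊆ S.P) : ∃ Φ : S.Frame, F₀ ⊆ Φ.F ∧ Q₀ ⊆ Φ.Q 0 := by
  have H := S.isUnitalSemigraph
  let F : Set (AdjoinUnit S.T) := {x | AlignedClosure S.unital S.deg F₀ x}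
  have hF : F.Finite := AlignedClosure.finite H S.semigraph.finitelyAligned hF₀
  -- The sources of all elements of `F` are included from the start, so closure under products also
  -- gives `Q_source`.
  let Good (C : Set X) : Prop := C.Finite ∧ C ⊆ S.P ∧ (∀ p ∈ C, ∀ q ∈ C, p * q ∈ C) ∧
    ∀ t : S.T, .of t ∈ F → star (t : X) * t ∈ C
  have hinit : ∃ C, Good C ∧ Q₀ ⊆ C := by
    have hfin : {x : X | ∃ t : S.T, .of t ∈ F ∧ x = star (t : X) * t}.Finite := by
      refine (hF.biUnion (t := fun s => {x : X | ∃ t : S.T, .of t = s ∧ x = star (t : X) * t})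
        fun s _ => Set.Subsingleton.finite ?_).subset ?_
      · rintro x ⟨t, rfl, rfl⟩ y ⟨t', h, rfl⟩
        cases h
        rfl
      · rintro x ⟨t, ht, rfl⟩
        simp only [Set.mem_iUnion]
        exact ⟨.of t, ht, t, rfl, rfl⟩
    obtain ⟨C, h1, h2, h3, h4⟩ := S.exists_finite_mul_closed (hQ₀.union hfin)
      (Set.union_subset hQP (by rintro x ⟨t, -, rfl⟩; exact S.star_mul_self_mem t))
    exact ⟨C, ⟨h1, h3, h4, fun t ht => h2 (Or.inr ⟨t, ht, rfl⟩)⟩, fun x hx => h2 (Or.inl hx)⟩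
  have hstep : ∀ C : {C // Good C}, ∃ C' : {C // Good C}, C.1 ⊆ C'.1 ∧
      ∀ t ∈ F, ∀ z ∈ F, ∀ α, S.unital.mul t α = some z → ∀ p ∈ C.1, ∀ q : X,
        (q : Unitization ℂ X) = star α.val * p * α.val → q ∈ C'.1 := by
    rintro ⟨C, hC, hCP, hmul, hsrc⟩
    let A : Set X := ⋃ t ∈ F, ⋃ z ∈ F, ⋃ p ∈ C, {q | ∃ α, S.unital.mul t α = some z ∧
      (q : Unitization ℂ X) = star α.val * p * α.val}
    -- By left cancellation `t` and `z` determine `α`, so each triple `t, z, p` contributes at most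
    -- one projection.
    have hA : A.Finite := by
      refine hF.biUnion fun t _ => hF.biUnion fun z _ => hC.biUnion fun p _ =>
        Set.Subsingleton.finite ?_
      rintro q ⟨α, hα, hq⟩ q' ⟨α', hα', hq'⟩
      obtain rfl := H.left_cancel hα hα'
      exact Unitization.inr_injective (R := ℂ) (hq.trans hq'.symm)
    have hAP : A ⊆ S.P := by
      intro q hq
      simp only [A, Set.mem_iUnion] at hq
      obtain ⟨t, -, z, -, p, hp, α, -, hq⟩ := hq
      obtain ⟨q', hq', h⟩ := conj_val_mem (S := S) ⟨p, hCP hp, rfl⟩ α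
      have : q = q' := Unitization.inr_injective (R := ℂ) (hq.trans h.symm)
      rwa [this]
    obtain ⟨C', h1, h2, h3, h4⟩ := S.exists_finite_mul_closed (hC.union hA)
      (Set.union_subset hCP hAP)
    refine ⟨⟨C', h1, h3, h4, fun t ht => h2 (Or.inl (hsrc t ht))⟩, fun x hx => h2 (Or.inl hx),
      fun t ht z hz α hα p hp q hq => h2 (Or.inr ?_)⟩
    simp only [A, Set.mem_iUnion]
    exact ⟨t, ht, z, hz, p, hp, α, hα, hq⟩
  obtain ⟨C₀, hC₀, hQC⟩ := hinit
  choose f hf hf' using hstep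
  let Q : ℕ → {C // Good C} := fun r => Nat.rec ⟨C₀, hC₀⟩ (fun _ C => f C) r
  refine ⟨{ F := F, Q := fun r => (Q r).1, finite_F := hF, F_step := ?_,
            finite_Q := fun r => (Q r).2.1, Q_subset := fun r => (Q r).2.2.1,
            Q_mono := monotone_nat_of_le_succ fun r => hf (Q r),
            Q_mul := fun r => (Q r).2.2.2.1, Q_source := ?_,
            Q_conj := fun r => hf' (Q r) }, fun x hx => .base hx, hQC⟩
  · intro s t x y z γ γ' hs ht hx hd h1 h2 h3 h4
    exact AlignedClosure.step hs ht hx hd h1 h2 h3 h4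
  · rintro r (_ | t) hz p hp q hq
    · have : q = p := Unitization.inr_injective (R := ℂ) (by simpa [AdjoinUnit.val] using hq)
      rwa [this]
    · have : q = star (t : X) * t * p :=
        Unitization.inr_injective (R := ℂ) (by simpa [AdjoinUnit.val] using hq)
      rw [this]
      exact (Q r).2.2.2.1 _ ((Q r).2.2.2.2 t hz) p hp

/-- The embedding of degrees into `ℤᵏ`. -/
noncomputable def intDegree : (k →₀ ℕ) →+ (k →₀ ℤ) :=
  Finsupp.mapRange.addMonoidHom (Nat.castAddMonoidHom ℤ)

lemma intDegree_injective : Function.Injective (intDegree (k := k)) :=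
  Finsupp.mapRange_injective _ Nat.cast_zero Nat.cast_injective

/-- The span of all standard words of degree `n`. -/
noncomputable def fiber (n : k →₀ ℤ) : Submodule ℂ X :=
  Submodule.span ℂ {x | ∃ s, ∃ p ∈ S.P, ∃ t,
    intDegree (S.deg s) - intDegree (S.deg t) = n ∧ x = S.word s p t}

/-- The relation `d(t) + d(α) = d(s') + d(β)` makes the degree of `(sα) r (t'β)*` the sum of the two
given degrees. -/
lemma mul_mem_fiber {n m : k →₀ ℤ} {x y : X} (hx : x ∈ S.fiber n) (hy : y ∈ S.fiber m) :
    x * y ∈ S.fiber (n + m) := by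
  have H := S.isUnitalSemigraph
  refine Submodule.mul_mem_of_span ?_ hx hy
  rintro _ ⟨s, p, hp, t, rfl, rfl⟩ _ ⟨s', p', hp', t', rfl, rfl⟩
  refine Submodule.span_mono ?_ (S.word_mul hp hp' s t s' t')
  rintro _ ⟨a, z, u, u', r, h1, h2, -, hu, hu', hr, -, rfl⟩
  refine ⟨u, r, hr, u', ?_, rfl⟩
  have e := (H.degree_mul _ _ _ h1).symm.trans (H.degree_mul _ _ _ h2)
  have e := congrArg intDegree e
  rw [map_add, map_add] at e
  rw [H.degree_mul _ _ _ hu, H.degree_mul _ _ _ hu', map_add, map_add]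
  have e' : intDegree (S.deg a.1) =
      intDegree (S.deg s') + intDegree (S.deg a.2) - intDegree (S.deg t) := by
    rw [← e]; abel
  rw [e']
  abel

lemma letterEval_mem_fiber (a : StarLetter S.P S.T) :
    letterEval a ∈ S.fiber (letterDegree S.degree a) := by
  have hsub : ∀ x : k →₀ ℤ, x - intDegree 0 = x := by simp
  rcases a with ⟨p | t, b⟩
  · have hp : letterEval ((.inl p, b) : StarLetter S.P S.T) = S.word .one p .one := by
      apply Unitization.inr_injective (R := ℂ)
      rw [coe_word]
      cases b <;> simp [letterEval, AdjoinUnit.val, (S.isProj p p.2).2]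
    exact Submodule.subset_span ⟨.one, p, p.2, .one, by simp [letterDegree], hp⟩
  · have ht := S.val_mul_star_mul_val (.of t)
    have ht' := congrArg star ht
    rw [star_mul, star_mul, star_star] at ht'
    simp only [AdjoinUnit.val] at ht ht'
    cases b
    -- As a partial isometry, `t = t (t* t) 1*` is itself a standard word; its adjoint is treated
    -- symmetrically.
    · refine Submodule.subset_span ⟨.of t, star (t : X) * t, S.star_mul_self_mem t, .one, ?_, ?_⟩
      · exact hsub _
      · apply Unitization.inr_injective (R := ℂ)
        rw [coe_word]
        simp only [letterEval, AdjoinUnit.val, star_one, mul_one]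
        rw [Unitization.inr_mul, Unitization.inr_star, ht]
    · refine Submodule.subset_span ⟨.one, star (t : X) * t, S.star_mul_self_mem t, .of t, ?_, ?_⟩
      · change intDegree 0 - _ = _
        rw [map_zero, zero_sub]
        rfl
      · apply Unitization.inr_injective (R := ℂ)
        rw [coe_word]
        simp only [letterEval, AdjoinUnit.val, one_mul]
        rw [Unitization.inr_mul, Unitization.inr_star, ht']

lemma wordEval_mem_fiber (w : StarWord S.P S.T) :
    wordEval w ∈ S.fiber (wordDegree S.degree w) := by
  induction w using FreeSemigroup.recOnMul with
  | ih1 a => exact S.letterEval_mem_fiber a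
  | ih2 a w ha hw =>
    have h1 : wordEval (FreeSemigroup.of a * w) =
        (wordEval (FreeSemigroup.of a) : X) * wordEval w := map_mul _ _ _
    have h2 : wordDegree S.degree (FreeSemigroup.of a * w) =
        wordDegree S.degree (FreeSemigroup.of a) + wordDegree S.degree w := by
      simp only [wordDegree, map_mul, toAdd_mul]
    rw [h1, h2]
    exact S.mul_mem_fiber ha hw

lemma fiber_zero : S.fiber 0 =
    Submodule.span ℂ {x | ∃ s, ∃ p ∈ S.P, ∃ t, S.deg s = S.deg t ∧ x = S.word s p t} := by
  simp only [fiber, sub_eq_zero, intDegree_injective.eq_iff]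

lemma word_mem_core {s t : AdjoinUnit S.T} (hd : S.deg s = S.deg t) {p : X} (hp : p ∈ S.P) :
    S.word s p t ∈ S.core := by
  have H := S.isUnitalSemigraph
  refine Submodule.subset_span ?_
  rcases s with _ | s
  · obtain rfl := H.eq_one (hd.symm.trans H.degree_one)
    refine ⟨FreeSemigroup.of (.inl ⟨p, hp⟩, false), rfl, ?_⟩
    apply Unitization.inr_injective (R := ℂ)
    rw [coe_word]
    simp [wordEval, letterEval, AdjoinUnit.val]
  rcases t with _ | t
  · cases H.eq_one (hd.trans H.degree_one)
  refine ⟨FreeSemigroup.of (.inr s, false) * FreeSemigroup.of (.inl ⟨p, hp⟩, false) *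
    FreeSemigroup.of (.inr t, true), ?_, ?_⟩
  · have hd : S.degree s = S.degree t := hd
    simp only [wordDegree, map_mul, toAdd_mul, FreeSemigroup.lift_of, toAdd_ofAdd, letterDegree, hd]
    simp
  · apply Unitization.inr_injective (R := ℂ)
    rw [coe_word]
    simp [wordEval, letterEval, AdjoinUnit.val]

lemma core_eq_fiber_zero : S.core = S.fiber 0 := by
  apply le_antisymm
  · refine Submodule.span_le.2 ?_
    rintro _ ⟨w, hw, rfl⟩
    rw [SetLike.mem_coe, ← hw]
    exact S.wordEval_mem_fiber w
  · rw [fiber_zero]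
    refine Submodule.span_le.2 ?_
    rintro _ ⟨s, p, hp, t, hd, rfl⟩
    exact S.word_mem_core hd hp

lemma mul_mem_core {x y : X} (hx : x ∈ S.core) (hy : y ∈ S.core) : x * y ∈ S.core := by
  rw [core_eq_fiber_zero] at *
  simpa using S.mul_mem_fiber hx hy

lemma standardProjections_subset_core {e : X} (he : e ∈ S.standardProjections) : e ∈ S.core := by
  rw [standardProjections_eq] at he
  have hb : ∀ z ∈ S.basicProjections, z ∈ S.core := by
    rintro _ ⟨s, p, hp, rfl⟩
    exact S.word_mem_core rfl hp
  change Refinement _ e at he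
  induction he with
  | basic h => exact hb _ h
  | diff _ h ih => exact S.core.sub_mem ih (S.mul_mem_core ih (hb _ h))

lemma Frame.algebra_le_core {S : SemigraphAlgebra k X} (Φ : S.Frame) : Φ.algebra ≤ S.core := by
  rw [core_eq_fiber_zero, fiber_zero]
  exact Φ.algebra_le

/-- Every finite subset of the core lies in the algebra of a frame. -/
lemma exists_frame_of_finite {U : Set X} (hU : U.Finite) (hUc : U ⊆ S.core) :
    ∃ Φ : S.Frame, U ⊆ Φ.algebra := by
  rw [core_eq_fiber_zero, fiber_zero] at hUc
  have hex : ∀ x ∈ U, ∃ A : Finset X, (A : Set X) ⊆ {x | ∃ s, ∃ p ∈ S.P, ∃ t,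
      S.deg s = S.deg t ∧ x = S.word s p t} ∧ x ∈ Submodule.span ℂ (A : Set X) :=
    fun x hx => Submodule.mem_span_finite_of_mem_span (hUc hx)
  choose! A hA hxA using hex
  let W : Set X := ⋃ x ∈ U, (A x : Set X)
  have hW : W.Finite := hU.biUnion fun x _ => (A x).finite_toSet
  have hword : ∀ x ∈ W, ∃ s, ∃ p, ∃ t, p ∈ S.P ∧ S.deg s = S.deg t ∧ x = S.word s p t := by
    intro x hx
    simp only [W, Set.mem_iUnion] at hx
    obtain ⟨y, hy, hx⟩ := hx
    obtain ⟨s, p, hp, t, hd, h⟩ := hA y hy hx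
    exact ⟨s, p, t, hp, hd, h⟩
  have : Nonempty (AdjoinUnit S.T) := ⟨.one⟩
  choose! s p t hp hd hx using hword
  -- One frame is taken around all outer factors and projections of the finitely many standard words
  -- needed to express `U`.
  obtain ⟨Φ, hF, hQ⟩ := S.exists_frame ((hW.image s).union (hW.image t)) (hW.image p)
    (by rintro _ ⟨x, hx, rfl⟩; exact hp x hx)
  refine ⟨Φ, fun x hxU => ?_⟩
  refine (Submodule.span_le.2 ?_ : Submodule.span ℂ (A x : Set X) ≤ Φ.algebra) (hxA x hxU)
  intro y hy
  have hyW : y ∈ W := by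
    simp only [W, Set.mem_iUnion]
    exact ⟨x, hxU, hy⟩
  rw [hx y hyW]
  exact Φ.word_mem_algebra (hF (Or.inl ⟨y, hyW, rfl⟩)) (hF (Or.inr ⟨y, hyW, rfl⟩)) (hd y hyW)
    (hQ ⟨y, hyW, rfl⟩)

end SemigraphAlgebra

lemma IsMatricial.exists_finite_span {X : Type*} [NonUnitalRing X] [StarRing X] [Module ℂ X]
    {D : X → Prop} {V : Submodule ℂ X} (hV : IsMatricial D V) :
    ∃ U : Set X, U.Finite ∧ V = Submodule.span ℂ U := by
  obtain ⟨m, n, E, -, -, rfl⟩ := hV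
  exact ⟨E.units, E.finite_units, rfl⟩

/-! ### The directed union and injectivity on the core -/

theorem corollary6p3 {k : Type*} {X : Type*} [NonUnitalRing X] [StarRing X] [Module ℂ X]
    [IsScalarTower ℂ X X] [SMulCommClass ℂ X X] [StarModule ℂ X] (S : SemigraphAlgebra k X) :
    (∃ 𝒜 : Set (NonUnitalStarSubalgebra ℂ X), 𝒜.Nonempty ∧ DirectedOn (· ≤ ·) 𝒜 ∧
      (S.core : Set X) = ⋃ A ∈ 𝒜, (A : Set X) ∧
      ∀ A ∈ 𝒜, IsFiniteDimensionalCStarAlgebra A ∧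
        HasMatrixRepresentation A S.standardProjections) ∧
    ∀ (B : Type*) [NonUnitalCStarAlgebra B] (π : X →⋆ₙₐ[ℂ] B),
      Set.InjOn π (S.core : Set X) ↔ ∀ e ∈ S.standardProjections, e ≠ 0 → π e ≠ 0 := by
  have hsub : ∀ Φ : S.Frame, ∃ A : NonUnitalStarSubalgebra ℂ X,
      (A : Set X) = Φ.algebra ∧ HasMatrixRepresentation A S.standardProjections := fun Φ =>
    Φ.isMatricial_algebra.exists_subalgebra S.standardProjections_mul_self
  have hcover : ∀ x ∈ S.core, ∃ Φ : S.Frame, x ∈ Φ.algebra := fun x hx => by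
    obtain ⟨Φ, hΦ⟩ := S.exists_frame_of_finite (Set.finite_singleton x)
      (Set.singleton_subset_iff.2 hx)
    exact ⟨Φ, hΦ rfl⟩
  refine ⟨⟨{A | HasMatrixRepresentation A S.standardProjections ∧
    ∃ Φ : S.Frame, (A : Set X) = Φ.algebra}, ?_, ?_, ?_, ?_⟩, ?_⟩
  · obtain ⟨Φ, -⟩ := hcover 0 S.core.zero_mem
    obtain ⟨A, hA, hrep⟩ := hsub Φ
    exact ⟨A, hrep, Φ, hA⟩
  · rintro A ⟨-, Φ, hA⟩ B ⟨-, Ψ, hB⟩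
    obtain ⟨U, hU, hΦ⟩ := Φ.isMatricial_algebra.exists_finite_span
    obtain ⟨U', hU', hΨ⟩ := Ψ.isMatricial_algebra.exists_finite_span
    -- Frames are not compared with each other: a third one is built around finite spanning sets of
    -- both algebras.
    obtain ⟨Θ, hΘ⟩ := S.exists_frame_of_finite (hU.union hU') (Set.union_subset
      (fun x hx => Φ.algebra_le_core (hΦ ▸ Submodule.subset_span hx))
      fun x hx => Ψ.algebra_le_core (hΨ ▸ Submodule.subset_span hx))
    obtain ⟨C, hC, hrep⟩ := hsub Θ
    refine ⟨C, ⟨hrep, Θ, hC⟩, ?_, ?_⟩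
    · change A ≤ C
      rw [← SetLike.coe_subset_coe, hA, hC, SetLike.coe_subset_coe, hΦ]
      exact Submodule.span_le.2 fun x hx => hΘ (Or.inl hx)
    · change B ≤ C
      rw [← SetLike.coe_subset_coe, hB, hC, SetLike.coe_subset_coe, hΨ]
      exact Submodule.span_le.2 fun x hx => hΘ (Or.inr hx)
  · ext x
    simp only [Set.mem_iUnion]
    constructor
    · intro hx
      obtain ⟨Φ, hΦ⟩ := hcover x hx
      obtain ⟨A, hA, hrep⟩ := hsub Φ
      exact ⟨A, ⟨hrep, Φ, hA⟩, hA ▸ hΦ⟩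
    · rintro ⟨A, ⟨-, Φ, hA⟩, hx⟩
      rw [hA] at hx
      exact Φ.algebra_le_core hx
  · rintro A ⟨hrep, -⟩
    exact ⟨hrep.isFiniteDimensionalCStarAlgebra, hrep⟩
  · intro B _ π
    constructor
    · intro hinj e he h0 hπ
      exact h0 (hinj (S.standardProjections_subset_core he) S.core.zero_mem
        (hπ.trans (map_zero π).symm))
    · intro hπ x hx y hy hxy
      -- The difference lies in a single matricial subspace, where nonvanishing on standard
      -- projections suffices.
      obtain ⟨Φ, hΦ⟩ := hcover (x - y) (S.core.sub_mem hx hy)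
      exact sub_eq_zero.1 (Φ.isMatricial_algebra.eq_zero_of_map_eq_zero
        S.standardProjections_mul_self π hπ hΦ (by rw [map_sub, hxy, sub_self]))
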